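/- All logarithms are natural. A finite set system $\mathcal F$ is $c$-approximate $k$-union closed if for at least a $c$-fraction of the ordered $k$-tuples $(A_1,\ldots,A_k)\in\mathcal F^k$ one has $A_1\cup\cdots\cup A_k\in\mathcal F$. For an integer $k\ge 2$ let $\psi_k$ be the unique real root of $(1-x)^k-x$ in $[0,1]$, let $\varphi_k=1-\psi_k$, $\alpha_k=\varphi_k^{\,k-1}$ and $\varphi=\frac{\sqrt5-1}{2}=\varphi_2$. Define $\mu_k=1/\alpha_k$ for $2\le k\le 4$, and for $k\ge 5$, with $p=\lfloor\log_2 k\rfloor$ and $q=k-2^p$, $$\mu_k=\frac{2^p-q}{2^p\varphi^p}+\frac{q}{2^p\varphi^{p+1}},$$ and let $z_k=1-\mu_k^{1/(1-k)}$. **Theorem.** (i) Let $k\ge 2$ and $0\le\varepsilon<\frac12$, and let $\mathcal F\subseteq 2^{[n]}$ be nonempty with $\mathcal F\ne\{\emptyset\}$ and $(1-\varepsilon)$-approximate $k$-union closed. Then some element of $[n]$ lies in at least a $z_k-\delta$ fraction of the sets of $\mathcal F$, where $$\delta=\left(k\varepsilon+\frac{2\varepsilon\log(1/\varepsilon)}{\log|\mathcal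 F|}\right)^{1/(k-1)}$$ (the second summand is read as $0$ if $\varepsilon=0$ or $|\mathcal F|=1$). (ii) $z_k=\psi_k$ for $k=2,3,4$. (iii) For every $k\ge2$: $z_k>\dfrac{\ln k}{3k}$ and $\dfrac12<\dfrac{z_k}{\psi_k}\le 1$. (iv) $\displaystyle\lim_{k\to\infty}\frac{z_k}{\psi_k}=\frac{\log(1/\varphi)}{\log 2}$, and this number differs from $0.6943$ by less than $10^{-4}$. -/

import Mathlib

open Finset Filter Topology

/-- A finite set system `F` is `c`-approximate `k`-union closed if at least a `c`-fraction of the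
ordered `k`-tuples `(A₁, …, A_k)` of members of `F` (repetitions allowed) have
`A₁ ∪ ⋯ ∪ A_k ∈ F`. -/
def IsApproxUnionClosed {α : Type*} [DecidableEq α] (k : ℕ) (c : ℝ)
    (F : Finset (Finset α)) : Prop :=
  c * ((Fintype.piFinset fun _ : Fin k => F).card : ℝ) ≤
    (((Fintype.piFinset fun _ : Fin k => F).filter
      fun A => (Finset.univ.biUnion A) ∈ F).card : ℝ)

theorem existsUnique_root (k : ℕ) :
    ∃! x : ℝ, x ∈ Set.Icc (0 : ℝ) 1 ∧ (1 - x) ^ k - x = 0 := by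
  have hc : ContinuousOn (fun x : ℝ => (1 - x) ^ k - x) (Set.Icc 0 1) := by fun_prop
  have h0 : (0 : ℝ) ∈ Set.Icc ((fun x : ℝ => (1 - x) ^ k - x) 1)
      ((fun x : ℝ => (1 - x) ^ k - x) 0) := by
    rcases Nat.eq_zero_or_pos k with rfl | hk
    · simp
    · simp [zero_pow hk.ne']
  obtain ⟨x, hx, hx0⟩ := intermediate_value_Icc' (zero_le_one : (0 : ℝ) ≤ 1) hc h0
  refine ⟨x, ⟨hx, hx0⟩, ?_⟩
  rintro y ⟨hy, hy0⟩
  simp only at hx0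
  rcases lt_trichotomy y x with h | h | h
  · have := pow_le_pow_left₀ (by linarith [hx.2] : (0 : ℝ) ≤ 1 - x)
      (by linarith : 1 - x ≤ 1 - y) k
    linarith
  · exact h
  · have := pow_le_pow_left₀ (by linarith [hy.2] : (0 : ℝ) ≤ 1 - y)
      (by linarith : 1 - y ≤ 1 - x) k
    linarith

/-- `ψ_k`: the unique real root of `(1 - x)^k - x` in `[0, 1]`. -/
noncomputable def psiConst (k : ℕ) : ℝ := (existsUnique_root k).choose

theorem psiConst_spec (k : ℕ) :
    psiConst k ∈ Set.Icc (0 : ℝ) 1 ∧ (1 - psiConst k) ^ k - psiConst k = 0 :=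
  (existsUnique_root k).choose_spec.1

theorem psiConst_unique (k : ℕ) {x : ℝ} (hx : x ∈ Set.Icc (0 : ℝ) 1)
    (h : (1 - x) ^ k - x = 0) : x = psiConst k :=
  (existsUnique_root k).choose_spec.2 x ⟨hx, h⟩

/-- `φ_k = 1 - ψ_k`. -/
noncomputable def phiConst (k : ℕ) : ℝ := 1 - psiConst k

/-- `α_k = φ_k ^ (k - 1)`, used for `k ≥ 2` only. -/
noncomputable def alphaConst (k : ℕ) : ℝ := phiConst k ^ (k - 1)

/-- `φ = (√5 - 1) / 2`. -/
noncomputable def phi : ℝ := (Real.sqrt 5 - 1) / 2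

theorem phiConst_two : phiConst 2 = phi := by
  have h5 : Real.sqrt 5 ^ 2 = 5 := Real.sq_sqrt (by norm_num)
  have hn : 0 ≤ Real.sqrt 5 := Real.sqrt_nonneg 5
  have h : 1 - phi = psiConst 2 := by
    apply psiConst_unique
    · unfold phi
      constructor <;> nlinarith
    · unfold phi
      nlinarith
  unfold phiConst
  linarith

/-- `μ_k`, for `k ≥ 2`: it is `1 / α_k` for `2 ≤ k ≤ 4`, and for `k ≥ 5`, with
`p = ⌊log₂ k⌋` and `q = k - 2^p`, it is `(2^p - q) / (2^p φ^p) + q / (2^p φ^(p+1))`. -/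
noncomputable def muConst (k : ℕ) : ℝ :=
  if k ≤ 4 then 1 / alphaConst k
  else
    let p : ℕ := Nat.log 2 k
    let q : ℝ := (k : ℝ) - 2 ^ p
    (2 ^ p - q) / (2 ^ p * phi ^ p) + q / (2 ^ p * phi ^ (p + 1))

/-- `z_k = 1 - μ_k ^ (1 / (1 - k))` (real exponent), for `k ≥ 2`. -/
noncomputable def zConst (k : ℕ) : ℝ := 1 - muConst k ^ (1 / (1 - (k : ℝ)))

/-! The proof is Gilmer's entropy method. Let A_1, …, A_k be independent uniform members of F, and
let every point be missed by at least a fraction x of F. Reveal the union point by point: given the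
k prefixes, the events i ∉ A_j are independent, with probabilities x_j say, so the conditional
entropy at i is h(x_1 ⋯ x_k), where h is the binary entropy. The inequality h(∏ x_j) ≥ (μ_k / k) ∑_l
h(x_l) ∏_{j ≠ l} x_j (`binEntropy_prod_ge`) then averages to H(A_1 ∪ ⋯ ∪ A_k) ≥ μ_k x^(k-1) log |F|
(`logFiberSum_union_le`). As most unions lie in F, this entropy is also at most (1 + (k-1)ε) log |F|
+ ε (`logFiberSum_union_ge`). Comparing the two bounds x from above, which is (i).

For the inequality, put x = e^(-t). Then G(t) = h(e^(-t)) e^t is concave (`concaveOn_expEntropy`),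
and Jensen reduces the claim to G(kt) ≥ μ_k G(t) (`expEntropy_nat_mul_ge`). For k ≤ 4 this follows
from the sign pattern of two derivatives, with equality at x = φ_k. Iterating k = 2 gives the
constant φ^(-p) for 2^p, and concavity interpolates between consecutive powers of two; this is the
formula for μ_k.

Evaluated at φ_k, the same inequality gives z_k ≤ ψ_k. The other comparisons rest on log μ_k ~ log k
· log(1/φ) / log 2, z_k ~ (log μ_k) / k and ψ_k ~ (log k) / k. -/

/-! ### Derivatives of the one-variable entropy gap. -/

theorem hasDerivAt_binEntropy_div_self {x : ℝ} (h0 : 0 < x) (h1 : x < 1) :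
    HasDerivAt (fun x => Real.binEntropy x / x) (Real.log (1 - x) / x ^ 2) x := by
  have h := (Real.hasDerivAt_binEntropy h0.ne' h1.ne).div (hasDerivAt_id x) h0.ne'
  refine HasDerivAt.congr_deriv (f := fun x => Real.binEntropy x / x) h ?_
  simp only [id, Real.binEntropy, Real.log_inv]
  ring

/-- `x` times the derivative of `t ↦ G(k t) - c G(t)`, where `G(t) = h(e⁻ᵗ) eᵗ` and `x = e⁻ᵗ`. -/
noncomputable def entropySlope (k : ℕ) (c x : ℝ) : ℝ :=
  -(k * Real.log (1 - x ^ k) / x ^ (k - 1)) + c * Real.log (1 - x)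

/-- `1 - x ^ k` times the derivative of `entropySlope k c`. -/
noncomputable def entropyCurv (k : ℕ) (c x : ℝ) : ℝ :=
  k ^ 2 + k * (k - 1) * ((1 - x ^ k) * Real.log (1 - x ^ k) / x ^ k) - c * ∑ j ∈ range k, x ^ j

theorem hasDerivAt_entropySlope {k : ℕ} (hk : 2 ≤ k) (c : ℝ) {x : ℝ} (h0 : 0 < x) (h1 : x < 1) :
    HasDerivAt (entropySlope k c) (entropyCurv k c x / (1 - x ^ k)) x := by
  obtain ⟨k, rfl⟩ : ∃ l, k = l + 2 := ⟨k - 2, by omega⟩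
  have hx : 0 < 1 - x ^ (k + 2) := by
    have := pow_lt_one₀ h0.le h1 (n := k + 2) (by omega)
    linarith
  have hx1 : 0 < 1 - x := by linarith
  have e1 : HasDerivAt (fun x : ℝ => 1 - x ^ (k + 2)) (-((k + 2 : ℕ) * x ^ (k + 1))) x := by
    simpa using (hasDerivAt_pow (k + 2) x).const_sub 1
  have e2 := ((e1.log hx.ne').const_mul ((k + 2 : ℕ) : ℝ)).div (hasDerivAt_pow (k + 1) x)
    (pow_pos h0 _).ne'
  have e3 : HasDerivAt (fun x : ℝ => 1 - x) (-1) x := by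
    simpa using (hasDerivAt_id x).const_sub 1
  have e4 := e2.neg.add ((e3.log hx1.ne').const_mul c)
  have hg : c * ∑ j ∈ range (k + 2), x ^ j = c * ((1 - x ^ (k + 2)) / (1 - x)) := by
    rw [geom_sum_eq h1.ne, ← neg_div_neg_eq]; congr 2 <;> ring
  refine HasDerivAt.congr_deriv (f := entropySlope (k + 2) c) e4 ?_
  rw [entropyCurv, hg]
  push_cast
  field_simp
  ring

theorem hasDerivAt_entropy_gap {k : ℕ} (hk : 2 ≤ k) (c : ℝ) {x : ℝ} (h0 : 0 < x) (h1 : x < 1) :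
    HasDerivAt (fun x => Real.binEntropy (x ^ k) / x ^ k - c * (Real.binEntropy x / x))
      (-entropySlope k c x / x ^ 2) x := by
  obtain ⟨k, rfl⟩ : ∃ l, k = l + 2 := ⟨k - 2, by omega⟩
  have hx := pow_lt_one₀ h0.le h1 (n := k + 2) (by omega)
  have e := (HasDerivAt.comp (h := fun x => x ^ (k + 2)) x
    (hasDerivAt_binEntropy_div_self (pow_pos h0 (k + 2)) hx) (hasDerivAt_pow (k + 2) x)).sub ((hasDerivAt_binEntropy_div_self h0 h1).const_mul c)
  refine HasDerivAt.congr_deriv (f := fun x => Real.binEntropy (x ^ (k + 2)) / x ^ (k + 2) -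
    c * (Real.binEntropy x / x)) e ?_
  rw [entropySlope]
  push_cast
  field_simp
  ring

/-- If `f' ≤ 0` (resp. `≥ 0`) on `[a, b]` then `f b ≤ f a` (resp. `f a ≤ f b`). -/
theorem le_of_hasDerivAt_nonneg {f f' : ℝ → ℝ} {a b : ℝ} (hab : a ≤ b)
    (hf : ∀ x ∈ Set.Icc a b, HasDerivAt f (f' x) x) (h : ∀ x ∈ Set.Icc a b, 0 ≤ f' x) :
    f a ≤ f b := by
  refine monotoneOn_of_deriv_nonneg (convex_Icc a b)
    (fun x hx => (hf x hx).continuousAt.continuousWithinAt)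
    (fun x hx => (hf x (interior_subset hx)).differentiableAt.differentiableWithinAt)
    (fun x hx => ?_) (Set.left_mem_Icc.2 hab) (Set.right_mem_Icc.2 hab) hab
  rw [(hf x (interior_subset hx)).deriv]
  exact h x (interior_subset hx)

theorem le_of_hasDerivAt_nonpos {f f' : ℝ → ℝ} {a b : ℝ} (hab : a ≤ b)
    (hf : ∀ x ∈ Set.Icc a b, HasDerivAt f (f' x) x) (h : ∀ x ∈ Set.Icc a b, f' x ≤ 0) :
    f b ≤ f a := by
  have := le_of_hasDerivAt_nonneg (f := fun x => -f x) (f' := fun x => -f' x) hab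
    (fun x hx => (hf x hx).neg) (fun x hx => by linarith [h x hx])
  linarith

/-! ### From the sign of `entropyCurv` to the one-variable inequality. -/

section SignPattern

variable {k : ℕ} {c m : ℝ}

/-- Here log(1 - m^k) = log m and log(1 - m) = k log m, so the two terms cancel exactly when c =
m^(1-k). -/
theorem entropySlope_eq_zero (hm0 : 0 < m) (hmk : m ^ k = 1 - m)
    (hc : c * m ^ (k - 1) = 1) : entropySlope k c m = 0 := by
  have h1 : c = 1 / m ^ (k - 1) := by
    rw [eq_div_iff (pow_pos hm0 _).ne', hc]
  rw [entropySlope, hmk, ← hmk, Real.log_pow, hmk, h1]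
  simp only [sub_sub_cancel]
  ring

/-- The set where `entropyCurv` ≤ 0 is an interval containing m, so on (0, m] the slope first
increases, starting from limit 0 at the origin, and then decreases to its zero at m. -/
theorem entropySlope_nonneg_of_le (hk : 2 ≤ k) (hm0 : 0 < m) (hm1 : m < 1)
    (hmk : m ^ k = 1 - m) (hc : c * m ^ (k - 1) = 1)
    (hV : (Set.Ioo (0 : ℝ) 1 ∩ {x | entropyCurv k c x ≤ 0}).OrdConnected)
    (hVm : entropyCurv k c m ≤ 0) {x : ℝ} (h0 : 0 < x) (hx : x ≤ m) :
    0 ≤ entropySlope k c x := by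
  have hpos : ∀ y : ℝ, 0 < y → y ≤ m → 0 < 1 - y ^ k := fun y h h' => by
    have := pow_lt_one₀ h.le (h'.trans_lt hm1) (n := k) (by omega)
    linarith
  by_cases hVx : entropyCurv k c x ≤ 0
  · rw [← entropySlope_eq_zero hm0 hmk hc]
    refine le_of_hasDerivAt_nonpos hx
      (fun y hy => hasDerivAt_entropySlope hk c (h0.trans_le hy.1) (hy.2.trans_lt hm1))
      fun y hy => div_nonpos_of_nonpos_of_nonneg ?_ (hpos y (h0.trans_le hy.1) hy.2).le
    exact (hV.out ⟨⟨h0, hx.trans_lt hm1⟩, hVx⟩ ⟨⟨hm0, hm1⟩, hVm⟩ hy).2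
  · have hlow : ∀ u ∈ Set.Ioo 0 x, c * Real.log (1 - u) ≤ entropySlope k c x := by
      intro u hu
      have hc0 : 0 < c := by
        by_contra hc0
        have := mul_nonpos_of_nonpos_of_nonneg (not_lt.1 hc0) (pow_pos hm0 (k - 1)).le
        linarith
      have h1 : c * Real.log (1 - u) ≤ entropySlope k c u := by
        have := hpos u hu.1 (hu.2.le.trans hx)
        have h2 : Real.log (1 - u ^ k) ≤ 0 :=
          Real.log_nonpos this.le (by linarith [pow_pos hu.1 k])
        have h3 : (k : ℝ) * Real.log (1 - u ^ k) / u ^ (k - 1) ≤ 0 :=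
          div_nonpos_of_nonpos_of_nonneg (mul_nonpos_of_nonneg_of_nonpos (by positivity) h2)
            (pow_pos hu.1 _).le
        rw [entropySlope]
        linarith
      refine h1.trans (le_of_hasDerivAt_nonneg hu.2.le
        (fun y hy => hasDerivAt_entropySlope hk c (hu.1.trans_le hy.1)
          ((hy.2.trans hx).trans_lt hm1))
        fun y hy => div_nonneg ?_ (hpos y (hu.1.trans_le hy.1) (hy.2.trans hx)).le)
      by_contra hneg
      exact hVx (hV.out ⟨⟨hu.1.trans_le hy.1, (hy.2.trans hx).trans_lt hm1⟩, (not_le.1 hneg).le⟩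
        ⟨⟨hm0, hm1⟩, hVm⟩ ⟨hy.2, hx⟩).2
    have hlim : Tendsto (fun u : ℝ => c * Real.log (1 - u)) (𝓝[>] 0) (𝓝 0) := by
      have : ContinuousAt (fun u : ℝ => c * Real.log (1 - u)) 0 := by
        refine continuousAt_const.mul (ContinuousAt.log (by fun_prop) (by norm_num))
      have h := this.tendsto.mono_left (nhdsWithin_le_nhds (s := Set.Ioi (0 : ℝ)))
      simpa using h
    exact le_of_tendsto hlim (eventually_of_mem (Ioo_mem_nhdsGT h0) hlow)

/-- To the right of m the slope first decreases from 0 and then increases, so it changes sign at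
most once there, from nonpositive to positive. -/
theorem entropySlope_nonpos_of_le (hk : 2 ≤ k) (hm0 : 0 < m)
    (hmk : m ^ k = 1 - m) (hc : c * m ^ (k - 1) = 1)
    (hV : (Set.Ioo (0 : ℝ) 1 ∩ {x | entropyCurv k c x ≤ 0}).OrdConnected)
    (hVm : entropyCurv k c m ≤ 0) {x y : ℝ} (hx : m ≤ x) (hxy : x ≤ y) (hy1 : y < 1)
    (hy : entropySlope k c y ≤ 0) : entropySlope k c x ≤ 0 := by
  have hpos : ∀ y : ℝ, 0 < y → y < 1 → 0 < 1 - y ^ k := fun y h h' => by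
    have := pow_lt_one₀ h.le h' (n := k) (by omega)
    linarith
  have hm1 : m < 1 := hx.trans_lt (hxy.trans_lt hy1)
  have hx0 : 0 < x := hm0.trans_le hx
  by_cases hVx : entropyCurv k c x ≤ 0
  · rw [← entropySlope_eq_zero hm0 hmk hc]
    refine le_of_hasDerivAt_nonpos hx
      (fun z hz => hasDerivAt_entropySlope hk c (hm0.trans_le hz.1)
        (hz.2.trans_lt (hxy.trans_lt hy1)))
      fun z hz => div_nonpos_of_nonpos_of_nonneg ?_
        (hpos z (hm0.trans_le hz.1) (hz.2.trans_lt (hxy.trans_lt hy1))).le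
    exact (hV.out ⟨⟨hm0, hm1⟩, hVm⟩ ⟨⟨hx0, hxy.trans_lt hy1⟩, hVx⟩ hz).2
  · refine le_trans (le_of_hasDerivAt_nonneg hxy
      (fun z hz => hasDerivAt_entropySlope hk c (hx0.trans_le hz.1) (hz.2.trans_lt hy1))
      fun z hz => div_nonneg ?_ (hpos z (hx0.trans_le hz.1) (hz.2.trans_lt hy1)).le) hy
    by_contra hneg
    exact hVx (hV.out ⟨⟨hm0, hm1⟩, hVm⟩
      ⟨⟨hx0.trans_le hz.1, hz.2.trans_lt hy1⟩, (not_le.1 hneg).le⟩ ⟨hx, hz.1⟩).2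

/-- The one-variable inequality `c h(x) / x ≤ h(x ^ k) / x ^ k`, with equality at `m`. -/
theorem binEntropy_div_le_of_entropyCurv (hk : 2 ≤ k) (hm0 : 0 < m) (hm1 : m < 1)
    (hmk : m ^ k = 1 - m) (hc : c * m ^ (k - 1) = 1)
    (hV : (Set.Ioo (0 : ℝ) 1 ∩ {x | entropyCurv k c x ≤ 0}).OrdConnected)
    (hVm : entropyCurv k c m ≤ 0) {x : ℝ} (h0 : 0 < x) (h1 : x < 1) :
    c * (Real.binEntropy x / x) ≤ Real.binEntropy (x ^ k) / x ^ k := by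
  set f : ℝ → ℝ := fun x => Real.binEntropy (x ^ k) / x ^ k - c * (Real.binEntropy x / x) with hf
  have hfm : f m = 0 := by
    have h2 : m ^ k = m * m ^ (k - 1) := by rw [← pow_succ']; congr 1; omega
    simp only [hf]
    have h3 : Real.binEntropy (m ^ k) = Real.binEntropy m := by
      rw [hmk, Real.binEntropy_one_sub]
    have h4 : c = 1 / m ^ (k - 1) := by rw [eq_div_iff (pow_pos hm0 _).ne', hc]
    rw [h3, h2, h4]
    field_simp
    ring
  suffices 0 ≤ f x by simp only [hf] at this; linarith
  rcases le_total x m with hxm | hxm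
  · rw [← hfm]
    refine le_of_hasDerivAt_nonpos hxm
      (fun y hy => hasDerivAt_entropy_gap hk c (h0.trans_le hy.1) (hy.2.trans_lt hm1))
      fun y hy => ?_
    have := entropySlope_nonneg_of_le hk hm0 hm1 hmk hc hV hVm (h0.trans_le hy.1) hy.2
    exact div_nonpos_of_nonpos_of_nonneg (by linarith) (by positivity)
  by_cases hQ : entropySlope k c x ≤ 0
  · rw [← hfm]
    refine le_of_hasDerivAt_nonneg hxm
      (fun y hy => hasDerivAt_entropy_gap hk c (hm0.trans_le hy.1) (hy.2.trans_lt h1))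
      fun y hy => ?_
    have := entropySlope_nonpos_of_le hk hm0 hmk hc hV hVm hy.1 hy.2 h1 hQ
    exact div_nonneg (by linarith) (by positivity)
  -- Once the slope is positive it stays so up to 1, hence f decreases from x to its limit 0 at 1.
  · have hle : ∀ u ∈ Set.Ioo x 1, f u ≤ f x := by
      intro u hu
      refine le_of_hasDerivAt_nonpos hu.1.le
        (fun y hy => hasDerivAt_entropy_gap hk c (h0.trans_le hy.1) (hy.2.trans_lt hu.2))
        fun y hy => div_nonpos_of_nonpos_of_nonneg ?_ (by positivity)
      by_contra hneg
      exact hQ (entropySlope_nonpos_of_le hk hm0 hmk hc hV hVm hxm hy.1 (hy.2.trans_lt hu.2)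
        (by linarith))
    have hlim : Tendsto f (𝓝[<] 1) (𝓝 0) := by
      have : ContinuousAt f 1 := by
        have e := Real.binEntropy_continuous
        refine ContinuousAt.sub (ContinuousAt.div (by fun_prop) (by fun_prop) (by simp))
          (continuousAt_const.mul (ContinuousAt.div (by fun_prop) (by fun_prop) (by simp)))
      have h := this.tendsto.mono_left (nhdsWithin_le_nhds (s := Set.Iio (1 : ℝ)))
      simpa [hf] using h
    exact le_of_tendsto hlim (eventually_of_mem (Ioo_mem_nhdsLT h1) hle)

end SignPattern

/-! ### Convexity of `entropyCurv k c x / x` and its sign at m. -/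

/-- Subtract from the series of -log(1 - y) the same series shifted and divided by y: 1/(n+1) -
1/(n+2) = 1/((n+1)(n+2)). What matters later is that the coefficients are positive. -/
theorem hasSum_one_sub_mul_log {y : ℝ} (h0 : 0 < y) (h1 : y < 1) :
    HasSum (fun n : ℕ => y ^ (n + 1) / ((n + 1) * (n + 2)))
      (1 + (1 - y) * Real.log (1 - y) / y) := by
  have h := Real.hasSum_pow_div_log_of_abs_lt_one (x := y) (by rwa [abs_of_pos h0])
  have h2 := ((hasSum_nat_add_iff' 1).2 h).div_const y
  have h3 := h.sub h2
  have e : -Real.log (1 - y) - (-Real.log (1 - y) - ∑ i ∈ range 1, y ^ (i + 1) / ((i : ℝ) + 1)) / y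
      = 1 + (1 - y) * Real.log (1 - y) / y := by
    simp only [sum_range_one]
    field_simp
    ring
  rw [e] at h3
  refine h3.congr_fun fun n => ?_
  push_cast
  have : (n : ℝ) + 1 ≠ 0 := by positivity
  have : (n : ℝ) + 2 ≠ 0 := by positivity
  have : (n : ℝ) + 1 + 1 ≠ 0 := by positivity
  field_simp
  ring

/-- After the lowest terms are split off, the remaining series has nonnegative coefficients and is
therefore convex. Only the elementary part, where the sum with factor -c sits, has to be checked for
convexity. -/
theorem entropyCurv_div_eq {k : ℕ} (hk : 2 ≤ k) (c : ℝ) {x : ℝ} (h0 : 0 < x) (h1 : x < 1) :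
    HasSum (fun n : ℕ => (k : ℝ) * (k - 1) * (x ^ (k * (n + 2) - 1) / ((n + 2) * (n + 3))))
      (entropyCurv k c x / x - ((k - c) / x - c * ∑ j ∈ range (k - 1), x ^ j
        + k * (k - 1) / 2 * x ^ (k - 1))) := by
  have hy := pow_lt_one₀ h0.le h1 (n := k) (by omega)
  have h := ((hasSum_nat_add_iff' 1).2
    (hasSum_one_sub_mul_log (pow_pos h0 k) hy)).mul_left ((k : ℝ) * (k - 1) / x)
  obtain ⟨k, rfl⟩ : ∃ l, k = l + 1 := ⟨k - 1, by omega⟩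
  have e : ∑ j ∈ range (k + 1), x ^ j = 1 + x * ∑ j ∈ range k, x ^ j := by
    rw [sum_range_succ', mul_sum, add_comm]
    simp [pow_succ']
  have e3 : (k + 1 : ℕ) * ((k + 1 : ℕ) - 1 : ℝ) / x *
      (1 + (1 - x ^ (k + 1)) * Real.log (1 - x ^ (k + 1)) / x ^ (k + 1) -
        ∑ i ∈ range 1, (x ^ (k + 1)) ^ (i + 1) / (((i : ℝ) + 1) * (i + 2))) =
      entropyCurv (k + 1) c x / x - (((k + 1 : ℕ) - c) / x - c * ∑ j ∈ range (k + 1 - 1), x ^ j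
        + (k + 1 : ℕ) * ((k + 1 : ℕ) - 1) / 2 * x ^ (k + 1 - 1)) := by
    rw [entropyCurv, e]
    simp only [sum_range_one, Nat.add_sub_cancel]
    push_cast
    field_simp
    ring
  rw [← e3]
  refine h.congr_fun fun n => ?_
  have : (k + 1) * (n + 2) = (k + 1) * (n + 2) - 1 + 1 := by
    have : 0 < (k + 1) * (n + 2) := by positivity
    omega
  have e2 : (x ^ (k + 1)) ^ (n + 1 + 1) = x * x ^ ((k + 1) * (n + 2) - 1) := by
    rw [← pow_succ', ← this, ← pow_mul]
  rw [e2]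
  push_cast
  have : (n : ℝ) + 1 + 1 = n + 2 := by ring
  have : (n : ℝ) + 1 + 2 = n + 3 := by ring
  rw [‹(n : ℝ) + 1 + 1 = n + 2›, ‹(n : ℝ) + 1 + 2 = n + 3›]
  field_simp

theorem convexOn_entropyCurv_div {k : ℕ} (hk : 2 ≤ k) {c : ℝ}
    (h : ConvexOn ℝ (Set.Ioo (0 : ℝ) 1) (fun x => (k - c) / x - c * ∑ j ∈ range (k - 1), x ^ j
        + k * (k - 1) / 2 * x ^ (k - 1))) :
    ConvexOn ℝ (Set.Ioo (0 : ℝ) 1) (fun x => entropyCurv k c x / x) := by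
  have hR : ConvexOn ℝ (Set.Ioo (0 : ℝ) 1)
      (fun x => entropyCurv k c x / x - ((k - c) / x - c * ∑ j ∈ range (k - 1), x ^ j
        + k * (k - 1) / 2 * x ^ (k - 1))) := by
    refine ⟨convex_Ioo 0 1, fun x hx y hy a b ha hb hab => ?_⟩
    have hz := convex_Ioo (0 : ℝ) 1 hx hy ha hb hab
    refine hasSum_le (fun n => ?_) (entropyCurv_div_eq hk c hz.1 hz.2)
      (((entropyCurv_div_eq hk c hx.1 hx.2).mul_left a).add
        ((entropyCurv_div_eq hk c hy.1 hy.2).mul_left b))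
    have := (convexOn_pow (𝕜 := ℝ) (k * (n + 2) - 1)).2 hx.1.le hy.1.le ha hb hab
    simp only [smul_eq_mul] at this ⊢
    have hk1 : (1 : ℝ) ≤ k := by exact_mod_cast (by omega : 1 ≤ k)
    have hpos : 0 ≤ (k : ℝ) * (k - 1) / ((n + 2) * (n + 3)) :=
      div_nonneg (mul_nonneg (by linarith) (by linarith)) (by positivity)
    have h3 := mul_le_mul_of_nonneg_left this hpos
    refine le_trans (le_of_eq ?_) (h3.trans (le_of_eq ?_)) <;> ring
  exact (hR.add h).congr fun x _ => by simp

theorem ordConnected_entropyCurv {k : ℕ} (hk : 2 ≤ k) {c : ℝ}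
    (h : ConvexOn ℝ (Set.Ioo (0 : ℝ) 1) (fun x => (k - c) / x - c * ∑ j ∈ range (k - 1), x ^ j
        + k * (k - 1) / 2 * x ^ (k - 1))) :
    (Set.Ioo (0 : ℝ) 1 ∩ {x | entropyCurv k c x ≤ 0}).OrdConnected := by
  have h2 := ((convexOn_entropyCurv_div hk h).convex_le 0).ordConnected
  have e : Set.Ioo (0 : ℝ) 1 ∩ {x | entropyCurv k c x ≤ 0} =
      {x | x ∈ Set.Ioo (0 : ℝ) 1 ∧ entropyCurv k c x / x ≤ 0} :=
    Set.ext fun x => and_congr_right fun hx => by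
      change entropyCurv k c x ≤ 0 ↔ _
      rw [div_le_iff₀ hx.1, zero_mul]
  rwa [e]

theorem entropyCurv_nonpos {k : ℕ} (hk : 2 ≤ k) {m : ℝ} (hm0 : 0 < m) (hm1 : m < 1)
    (hmk : m ^ k = 1 - m) {c : ℝ} (hc : c * m ^ (k - 1) = 1)
    (h : (k : ℝ) ^ 2 - k * (k - 1) * (m * (1 + (1 - m) / 2)) ≤ c ^ 2) :
    entropyCurv k c m ≤ 0 := by
  have hlog : Real.log m ≤ -((1 - m) + (1 - m) ^ 2 / 2) := by
    have := Real.hasSum_pow_div_log_of_abs_lt_one (x := 1 - m)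
      (by rw [abs_of_pos (by linarith)]; linarith)
    have h2 := sum_le_hasSum (range 2) (fun i _ => by
      have : 0 < 1 - m := by linarith
      positivity) this
    simp only [sum_range_succ, sum_range_zero, sub_sub_cancel] at h2
    norm_num at h2
    linarith
  have hmk' : m * m ^ (k - 1) = 1 - m := by rw [← pow_succ', ← hmk]; congr 1; omega
  have hm2 : 0 < 1 - m := by linarith
  -- Because m^k = 1 - m, the geometric sum is m / (1 - m), which is c itself.
  have hgeom : c * ∑ j ∈ range k, m ^ j = c ^ 2 := by
    have h1 : ∑ j ∈ range k, m ^ j = m / (1 - m) := by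
      rw [geom_sum_eq hm1.ne, hmk, ← neg_div_neg_eq]; congr 1 <;> ring
    have h2 : c * (1 - m) = m := by rw [← hmk']; linear_combination m * hc
    rw [h1, eq_div_iff hm2.ne' |>.2 h2]; ring
  have hk1 : (1 : ℝ) ≤ k := by exact_mod_cast (by omega : 1 ≤ k)
  rw [entropyCurv, hmk, hgeom]
  simp only [sub_sub_cancel]
  have h3 : m * Real.log m / (1 - m) ≤ -(m * (1 + (1 - m) / 2)) := by
    rw [div_le_iff₀ hm2]
    have := mul_le_mul_of_nonneg_left hlog hm0.le
    linarith
  have := mul_le_mul_of_nonneg_left h3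
    (mul_nonneg (by linarith : (0 : ℝ) ≤ k) (by linarith : (0 : ℝ) ≤ (k : ℝ) - 1))
  linarith

/-! ### The root φ_k and the one-variable inequality for k = 2, 3, 4. -/

theorem psiConst_pos {k : ℕ} : 0 < psiConst k := by
  obtain ⟨h, h2⟩ := psiConst_spec k
  refine lt_of_le_of_ne h.1 fun h0 => ?_
  rw [← h0] at h2
  norm_num at h2

theorem psiConst_lt_one {k : ℕ} (hk : k ≠ 0) : psiConst k < 1 := by
  obtain ⟨h, h2⟩ := psiConst_spec k
  refine lt_of_le_of_ne h.2 fun h0 => ?_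
  rw [h0, sub_self, zero_pow hk] at h2
  norm_num at h2

theorem phiConst_pos {k : ℕ} (hk : k ≠ 0) : 0 < phiConst k := by
  rw [phiConst]; linarith [psiConst_lt_one hk]

theorem phiConst_lt_one (k : ℕ) : phiConst k < 1 := by
  rw [phiConst]; linarith [psiConst_pos (k := k)]

theorem phiConst_pow (k : ℕ) : phiConst k ^ k = 1 - phiConst k := by
  rw [phiConst]; linarith [(psiConst_spec k).2]

theorem one_div_alphaConst_mul {k : ℕ} (hk : k ≠ 0) :
    1 / alphaConst k * phiConst k ^ (k - 1) = 1 := by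
  rw [alphaConst, one_div, inv_mul_cancel₀ (pow_pos (phiConst_pos hk) _).ne']

theorem lt_phiConst {k : ℕ} {a : ℝ} (h : a ^ k < 1 - a) :
    a < phiConst k := by
  by_contra hcon
  rw [not_lt] at hcon
  rcases Nat.eq_zero_or_pos k with rfl | hk
  · linarith [phiConst_pow 0, hcon, pow_zero a, pow_zero (phiConst 0)]
  have := pow_le_pow_left₀ (phiConst_pos hk.ne').le hcon k
  linarith [phiConst_pow k]

theorem phiConst_lt {k : ℕ} {a : ℝ} (h0 : 0 ≤ a) (h : 1 - a < a ^ k) :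
    phiConst k < a := by
  by_contra hcon
  rw [not_lt] at hcon
  have := pow_le_pow_left₀ h0 hcon k
  linarith [phiConst_pow k]

theorem convexOn_const_div {a : ℝ} (ha : 0 ≤ a) :
    ConvexOn ℝ (Set.Ioo (0 : ℝ) 1) (fun x => a / x) := by
  have := ((convexOn_zpow (𝕜 := ℝ) (-1)).subset Set.Ioo_subset_Ioi_self (convex_Ioo 0 1)).smul ha
  simpa [div_eq_mul_inv] using this

/-- The one-variable inequality `h(x) / (α_k x) ≤ h(x ^ k) / x ^ k` for `k = 2, 3, 4`. -/
theorem binEntropy_pow_ge {k : ℕ} (hk : 2 ≤ k) (hk4 : k ≤ 4) {x : ℝ} (h0 : 0 < x) (h1 : x < 1) :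
    1 / alphaConst k * (Real.binEntropy x / x) ≤ Real.binEntropy (x ^ k) / x ^ k := by
  have hm0 := phiConst_pos (k := k) (by omega)
  have hm1 := phiConst_lt_one k
  have hmk := phiConst_pow k
  have hc := one_div_alphaConst_mul (k := k) (by omega)
  set c := 1 / alphaConst k
  set m := phiConst k with hm
  have h1m : 0 < 1 - m := by linarith
  have hcm : c * (1 - m) = m := by
    rw [← hmk, show k = k - 1 + 1 by omega, pow_succ]
    linear_combination m * hc
  have hc0 : 0 < c := by
    by_contra h
    nlinarith
  refine binEntropy_div_le_of_entropyCurv hk hm0 hm1 hmk hc (ordConnected_entropyCurv hk ?_)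
    (entropyCurv_nonpos hk hm0 hm1 hmk hc ?_) h0 h1
  -- Since c = m / (1 - m), an upper bound for m bounds c. For k = 2, 3 each summand is then convex;
  -- for k = 4 the term -c x² is concave and the second derivative is needed.
  · interval_cases k
    · have hu : m < 0.62 := by
        rw [hm]
        exact phiConst_lt (k := 2) (by norm_num) (by norm_num)
      have hc2 : c ≤ 2 := by nlinarith
      have := (convexOn_const_div (a := 2 - c) (by linarith)).add
        ((convexOn_id (convex_Ioo (0 : ℝ) 1)).add_const (-c))
      refine this.congr fun x _ => ?_
      simp
      ring
    · have hu : m < 0.7 := by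
        rw [hm]
        exact phiConst_lt (k := 3) (by norm_num) (by norm_num)
      have hc2 : c ≤ 3 := by nlinarith
      refine ((convexOn_const_div (a := 3 - c) (by linarith)).add
        ((((convexOn_pow 2).subset (fun x hx => hx.1.le) (convex_Ioo (0 : ℝ) 1)).smul
        (by norm_num : (0 : ℝ) ≤ 3)).add
        (((concaveOn_id (convex_Ioo (0 : ℝ) 1)).smul hc0.le).neg.add_const (-c)))).congr
        fun x _ => ?_
      simp [sum_range_succ]
      ring
    · have hu : m < 0.73 := by
        rw [hm]
        exact phiConst_lt (k := 4) (by norm_num) (by norm_num)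
      have hc2 : c ≤ 2.71 := by nlinarith
      have hd : ∀ x ∈ Set.Ioo (0 : ℝ) 1, HasDerivAt (fun x : ℝ => ((4 : ℕ) - c) / x -
          c * ∑ j ∈ range (4 - 1), x ^ j + (4 : ℕ) * ((4 : ℕ) - 1) / 2 * x ^ (4 - 1))
          (-(4 - c) * (x ^ 2)⁻¹ - c * (1 + 2 * x) + 18 * x ^ 2) x := by
        intro x hx
        have e1 : HasDerivAt (fun x : ℝ => ((4 : ℕ) - c) * x⁻¹ -
            c * ∑ j ∈ range (4 - 1), x ^ j + (4 : ℕ) * ((4 : ℕ) - 1) / 2 * x ^ (4 - 1)) _ x :=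
          (((hasDerivAt_inv hx.1.ne').const_mul ((4 : ℕ) - c)).sub
            ((HasDerivAt.fun_sum fun j _ => hasDerivAt_pow j x).const_mul c)).add
            ((hasDerivAt_pow (4 - 1) x).const_mul _)
        refine HasDerivAt.congr_deriv e1 ?_
        simp [sum_range_succ]
        ring
      refine convexOn_of_hasDerivWithinAt2_nonneg (convex_Ioo 0 1)
        (f' := fun x => -(4 - c) * (x ^ 2)⁻¹ - c * (1 + 2 * x) + 18 * x ^ 2)
        (f'' := fun x => 2 * (4 - c) / x ^ 3 - 2 * c + 36 * x) ?_ ?_ ?_ ?_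
      · exact fun x hx => (hd x hx).continuousAt.continuousWithinAt
      · rw [interior_Ioo]
        exact fun x hx => (hd x hx).hasDerivWithinAt
      · rw [interior_Ioo]
        intro x hx
        have e1 : HasDerivAt (fun x : ℝ => -(4 - c) * (x ^ 2)⁻¹ - c * (1 + 2 * x) + 18 * x ^ 2)
            _ x :=
          ((((hasDerivAt_pow 2 x).inv (pow_pos hx.1 2).ne').const_mul (-(4 - c))).sub
            ((((hasDerivAt_id x).const_mul 2).const_add 1).const_mul c)).add
            ((hasDerivAt_pow 2 x).const_mul 18)
        refine (HasDerivAt.congr_deriv e1 ?_).hasDerivWithinAt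
        have := hx.1.ne'
        push_cast
        field_simp
        ring
      · intro x hx
        rw [interior_Ioo] at hx
        -- The tangent line of x^(-3) at 1 makes the lower bound for the second derivative linear in
        -- x.
        have h3 : 4 - 3 * x ≤ 1 / x ^ 3 := by
          rw [le_div_iff₀ (pow_pos hx.1 3)]
          have : 0 ≤ (x - 1) ^ 2 * (3 * x ^ 2 + 2 * x + 1) :=
            mul_nonneg (sq_nonneg _) (by nlinarith [hx.1])
          linarith
        have h4 := mul_le_mul_of_nonneg_left h3 (by linarith : 0 ≤ 2 * (4 - c))
        have h5 := hx.1
        have h6 := hx.2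
        rw [mul_one_div] at h4
        nlinarith
  · interval_cases k
    · have hl : 0.6 < m := by
        rw [hm]
        exact lt_phiConst (k := 2) (by norm_num)
      have e : c = 1 + m := by
        refine mul_right_cancel₀ h1m.ne' (hcm.trans ?_)
        linear_combination hmk
      rw [e]
      push_cast
      nlinarith
    · have hl : 0.68 < m := by
        rw [hm]
        exact lt_phiConst (k := 3) (by norm_num)
      have hc3 : 2.12 < c := by nlinarith
      push_cast
      nlinarith
    · have hl : 0.72 < m := by
        rw [hm]
        exact lt_phiConst (k := 4) (by norm_num)
      have hc3 : 2.57 < c := by nlinarith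
      push_cast
      nlinarith

/-! ### Concavity in the logarithmic coordinate and the multivariate inequality. -/

/-- The binary entropy divided by the argument, in the logarithmic coordinate `x = e⁻ᵗ`. -/
noncomputable def expEntropy (t : ℝ) : ℝ := Real.binEntropy (Real.exp (-t)) / Real.exp (-t)

theorem expEntropy_zero : expEntropy 0 = 0 := by simp [expEntropy]

/-- With x = e^(-t) the second derivative is -log(1 - x)/x - 1/(1 - x), which is nonpositive by log
u ≤ u - 1 at u = 1/(1 - x). -/
theorem concaveOn_expEntropy : ConcaveOn ℝ (Set.Ici 0) expEntropy := by
  have hexp : ∀ t : ℝ, HasDerivAt (fun t => Real.exp (-t)) (-Real.exp (-t)) t := fun t => by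
    simpa using (hasDerivAt_neg t).exp
  refine concaveOn_of_hasDerivWithinAt2_nonpos (convex_Ici 0)
    (f' := fun t => -(Real.log (1 - Real.exp (-t)) / Real.exp (-t)))
    (f'' := fun t => -(Real.log (1 - Real.exp (-t)) / Real.exp (-t)) - 1 / (1 - Real.exp (-t)))
    ?_ ?_ ?_ ?_
  · refine (Continuous.div ?_ (by fun_prop) fun t => (Real.exp_pos _).ne').continuousOn
    exact Real.binEntropy_continuous.comp (by fun_prop)
  all_goals
    rw [interior_Ici]
    intro t ht
    have h1 : Real.exp (-t) < 1 := Real.exp_lt_one_iff.2 (by simpa using ht)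
    have h0 := Real.exp_pos (-t)
    have h2 : 0 < 1 - Real.exp (-t) := by linarith
  · refine (HasDerivAt.congr_deriv (HasDerivAt.comp (h := fun t => Real.exp (-t)) t
      (hasDerivAt_binEntropy_div_self h0 h1) (hexp t)) ?_).hasDerivWithinAt
    field_simp
  · refine (HasDerivAt.congr_deriv ((((hexp t).const_sub 1).log h2.ne').fun_div (hexp t)
      h0.ne').fun_neg ?_).hasDerivWithinAt
    field_simp
    ring
  · have h3 := Real.log_le_sub_one_of_pos (inv_pos.2 h2)
    rw [Real.log_inv] at h3
    have h4 : -(Real.log (1 - Real.exp (-t)) / Real.exp (-t)) ≤ 1 / (1 - Real.exp (-t)) := by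
      rw [← neg_div, div_le_iff₀ h0]
      refine h3.trans (le_of_eq ?_)
      field_simp
      ring
    linarith

theorem phi_pos : 0 < phi := by
  rw [← phiConst_two]; exact phiConst_pos (by norm_num)

theorem phi_lt_one : phi < 1 := by
  rw [← phiConst_two]; exact phiConst_lt_one 2

theorem phi_sq : phi ^ 2 = 1 - phi := by
  rw [← phiConst_two]; exact phiConst_pow 2

theorem expEntropy_nat_mul_ge_of_le_four {k : ℕ} (hk : 2 ≤ k) (hk4 : k ≤ 4) {t : ℝ} (ht : 0 ≤ t) :
    1 / alphaConst k * expEntropy t ≤ expEntropy (k * t) := by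
  rcases ht.eq_or_lt with rfl | ht
  · simp [expEntropy_zero]
  have h := binEntropy_pow_ge hk hk4 (Real.exp_pos (-t)) (Real.exp_lt_one_iff.2 (by linarith))
  rwa [← Real.exp_nat_mul, mul_neg] at h

theorem expEntropy_two_pow_mul_ge (p : ℕ) {t : ℝ} (ht : 0 ≤ t) :
    1 / phi ^ p * expEntropy t ≤ expEntropy (2 ^ p * t) := by
  induction p with
  | zero => simp
  | succ p ih =>
    have h := expEntropy_nat_mul_ge_of_le_four le_rfl (by norm_num)
      (mul_nonneg (by positivity : (0 : ℝ) ≤ 2 ^ p) ht)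
    rw [alphaConst, phiConst_two, pow_one] at h
    have h2 := mul_le_mul_of_nonneg_left ih (one_div_pos.2 phi_pos).le
    have e : ((2 : ℕ) : ℝ) * (2 ^ p * t) = 2 ^ (p + 1) * t := by push_cast; ring
    rw [e] at h
    refine le_trans (le_of_eq ?_) (h2.trans h)
    rw [pow_succ]
    field_simp

/-- The one-variable inequality with the constant `μ_k`. -/
theorem expEntropy_nat_mul_ge {k : ℕ} (hk : 2 ≤ k) {t : ℝ} (ht : 0 ≤ t) :
    muConst k * expEntropy t ≤ expEntropy (k * t) := by
  rw [muConst]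
  split_ifs with hk4
  · exact expEntropy_nat_mul_ge_of_le_four hk hk4 ht
  have hp : (2 : ℝ) ^ Nat.log 2 k ≤ k := by exact_mod_cast Nat.pow_log_le_self 2 (by omega)
  have hp' : (k : ℝ) ≤ 2 ^ Nat.log 2 k * 2 := by
    exact_mod_cast (pow_succ 2 (Nat.log 2 k) ▸ Nat.lt_pow_succ_log_self one_lt_two k).le
  simp only
  generalize Nat.log 2 k = p at *
  have h2 : (0 : ℝ) < 2 ^ p := by positivity
  have hmem : ∀ n : ℕ, 2 ^ n * t ∈ Set.Ici (0 : ℝ) := fun n =>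
    Set.mem_Ici.2 (mul_nonneg (by positivity) ht)
  have ha : 0 ≤ 1 - ((k : ℝ) - 2 ^ p) / 2 ^ p := by rw [sub_nonneg, div_le_one h2]; linarith
  have hb : 0 ≤ ((k : ℝ) - 2 ^ p) / 2 ^ p := div_nonneg (by linarith) h2.le
  have hc := concaveOn_expEntropy.2 (hmem p) (hmem (p + 1)) ha hb (by ring)
  -- With weight q / 2^p on the upper end, kt is a convex combination of 2^p t and 2^(p+1) t.
  have e : (1 - ((k : ℝ) - 2 ^ p) / 2 ^ p) * (2 ^ p * t) +
      ((k : ℝ) - 2 ^ p) / 2 ^ p * (2 ^ (p + 1) * t) = k * t := by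
    field_simp
    ring
  simp only [smul_eq_mul] at hc
  rw [e] at hc
  refine le_trans (le_trans (le_of_eq ?_) (add_le_add
    (mul_le_mul_of_nonneg_left (expEntropy_two_pow_mul_ge p ht) ha)
    (mul_le_mul_of_nonneg_left (expEntropy_two_pow_mul_ge (p + 1) ht) hb))) hc
  have := phi_pos
  field_simp

theorem muConst_pos {k : ℕ} (hk : 2 ≤ k) : 0 < muConst k := by
  rw [muConst]
  split_ifs with hk4
  · exact one_div_pos.2 (pow_pos (phiConst_pos (by omega)) _)
  have hp : (2 : ℝ) ^ Nat.log 2 k ≤ k := by exact_mod_cast Nat.pow_log_le_self 2 (by omega)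
  have hp' : (k : ℝ) < 2 ^ Nat.log 2 k * 2 := by
    exact_mod_cast pow_succ 2 (Nat.log 2 k) ▸ Nat.lt_pow_succ_log_self one_lt_two k
  have := phi_pos
  exact add_pos_of_pos_of_nonneg (div_pos (by linarith) (by positivity))
    (div_nonneg (by linarith) (by positivity))

/-- The multivariate entropy inequality for products of probabilities. -/
theorem binEntropy_prod_ge {k : ℕ} (hk : 2 ≤ k) {x : Fin k → ℝ} (h0 : ∀ i, 0 ≤ x i)
    (h1 : ∀ i, x i ≤ 1) :
    muConst k / k * ∑ i, Real.binEntropy (x i) * ∏ j ∈ univ.erase i, x j ≤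
      Real.binEntropy (∏ i, x i) := by
  have hk0 : (0 : ℝ) < k := by exact_mod_cast (by omega : 0 < k)
  have hμ := muConst_pos hk
  -- The coordinate -log x_i needs x_i > 0; if some x_i is 0, both sides vanish.
  by_cases hz : ∃ i, x i = 0
  · obtain ⟨i, hi⟩ := hz
    rw [prod_eq_zero (mem_univ i) hi, Real.binEntropy_zero, sum_eq_zero, mul_zero]
    intro j _
    by_cases hj : j = i
    · rw [hj, hi, Real.binEntropy_zero, zero_mul]
    · rw [prod_eq_zero (mem_erase.2 ⟨Ne.symm hj, mem_univ i⟩) hi, mul_zero]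
  have hpos : ∀ i, 0 < x i := fun i => lt_of_le_of_ne (h0 i) fun h => hz ⟨i, h.symm⟩
  have hx : ∀ i, Real.exp (-(-Real.log (x i))) = x i := fun i => by
    rw [neg_neg, Real.exp_log (hpos i)]
  have ht : ∀ i, 0 ≤ -Real.log (x i) := fun i => by
    linarith [Real.log_nonpos (h0 i) (h1 i)]
  have hP : 0 < ∏ i, x i := prod_pos fun i _ => hpos i
  have hG : ∀ i, expEntropy (-Real.log (x i)) = Real.binEntropy (x i) / x i := fun i => by
    rw [expEntropy, hx]
  have hGP : expEntropy (∑ i, -Real.log (x i)) = Real.binEntropy (∏ i, x i) / ∏ i, x i := by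
    have : Real.exp (-∑ i, -Real.log (x i)) = ∏ i, x i := by
      rw [sum_neg_distrib, neg_neg, ← Real.log_prod fun i _ => (hpos i).ne', Real.exp_log hP]
    rw [expEntropy, this]
  have hJ := concaveOn_expEntropy.le_map_sum (t := univ) (w := fun _ : Fin k => 1 / (k : ℝ))
    (p := fun i => -Real.log (x i)) (fun _ _ => by positivity)
    (by simp [hk0.ne']) (fun i _ => ht i)
  simp only [smul_eq_mul, ← mul_sum] at hJ
  have hS : 0 ≤ 1 / (k : ℝ) * ∑ i, -Real.log (x i) :=
    mul_nonneg (by positivity) (sum_nonneg fun i _ => ht i)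
  have hM := expEntropy_nat_mul_ge hk hS
  rw [← mul_assoc, mul_one_div_cancel hk0.ne', one_mul, hGP, le_div_iff₀ hP] at hM
  refine le_trans (le_of_eq ?_) ((mul_le_mul_of_nonneg_right
    (mul_le_mul_of_nonneg_left hJ hμ.le) hP.le).trans hM)
  have e : (∑ i, expEntropy (-Real.log (x i))) * ∏ i, x i =
      ∑ i, Real.binEntropy (x i) * ∏ j ∈ univ.erase i, x j := by
    rw [sum_mul]
    refine sum_congr rfl fun i _ => ?_
    rw [hG, ← mul_prod_erase univ x (mem_univ i)]
    have := (hpos i).ne'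
    field_simp
  rw [← e]
  ring

/-! ### Size of μ_k, z_k and ψ_k. -/

theorem one_div_phi : 1 / phi = 1 + phi := by
  have := phi_pos
  rw [div_eq_iff this.ne']
  linear_combination -phi_sq

/-- Here s = q / 2^p, and 1/φ - 1 = φ turns the interpolation into 1 + φ s. Logarithms of k and μ_k
can then be compared factor by factor. -/
theorem muConst_of_four_lt {k : ℕ} (hk : 4 < k) : ∃ s : ℝ, 0 ≤ s ∧ s ≤ 1 ∧
    (k : ℝ) = 2 ^ Nat.log 2 k * (1 + s) ∧
    muConst k = (1 / phi) ^ Nat.log 2 k * (1 + phi * s) := by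
  have hp : (2 : ℝ) ^ Nat.log 2 k ≤ k := by exact_mod_cast Nat.pow_log_le_self 2 (by omega)
  have hp' : (k : ℝ) ≤ 2 ^ Nat.log 2 k * 2 := by
    exact_mod_cast (pow_succ 2 (Nat.log 2 k) ▸ Nat.lt_pow_succ_log_self one_lt_two k).le
  rw [muConst, if_neg (by omega)]
  simp only
  generalize Nat.log 2 k = p at *
  have h2 : (0 : ℝ) < 2 ^ p := by positivity
  refine ⟨(k - 2 ^ p) / 2 ^ p, div_nonneg (by linarith) h2.le, ?_, ?_, ?_⟩
  · rw [div_le_one h2]; linarith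
  · field_simp; ring
  · have := phi_pos
    rw [one_div_pow, pow_succ]
    field_simp
    linear_combination (2 ^ p - (k : ℝ)) * phi_sq

theorem log_one_add_mul_ge {s : ℝ} (hs : 0 ≤ s) :
    phi * Real.log (1 + s) ≤ Real.log (1 + phi * s) := by
  rw [← Real.log_rpow (by linarith)]
  exact Real.log_le_log (Real.rpow_pos_of_pos (by linarith) _)
    (rpow_one_add_le_one_add_mul_self (by linarith) phi_pos.le phi_lt_one.le)

theorem log_one_div_phi_ge : phi * Real.log 2 ≤ Real.log (1 / phi) := by
  have := log_one_add_mul_ge zero_le_one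
  rw [one_div_phi]
  norm_num at this ⊢
  exact this

theorem log_one_div_phi_pos : 0 < Real.log (1 / phi) :=
  (mul_pos phi_pos (Real.log_pos one_lt_two)).trans_le log_one_div_phi_ge

section LogMu

variable {k : ℕ}

/-- Bernoulli's inequality (1 + s)^φ ≤ 1 + φ s is used twice: at s = 1 it gives 2^φ ≤ 1/φ for the
power of two, and at the given s it handles the remaining factor. -/
theorem phi_mul_log_le_log_muConst (hk : 4 < k) : phi * Real.log k ≤ Real.log (muConst k) := by
  obtain ⟨s, h0, -, h2, h3⟩ := muConst_of_four_lt hk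
  have hφ := phi_pos
  rw [h3, h2, Real.log_mul (by positivity) (by positivity),
    Real.log_mul (by positivity) (by positivity), Real.log_pow, Real.log_pow]
  have := mul_le_mul_of_nonneg_left log_one_div_phi_ge (Nat.cast_nonneg (α := ℝ) (Nat.log 2 k))
  have := log_one_add_mul_ge h0
  linarith

theorem log_muConst_ge (hk : 4 < k) :
    (Real.log k / Real.log 2 - 1) * Real.log (1 / phi) ≤ Real.log (muConst k) := by
  obtain ⟨s, h0, h1, h2, h3⟩ := muConst_of_four_lt hk
  have hφ := phi_pos
  have hl := Real.log_pos one_lt_two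
  have e1 : Real.log k / Real.log 2 - 1 ≤ Nat.log 2 k := by
    rw [h2, Real.log_mul (by positivity) (by positivity), Real.log_pow, sub_le_iff_le_add,
      div_le_iff₀ hl, add_mul, one_mul]
    gcongr
    linarith
  have e2 : Nat.log 2 k * Real.log (1 / phi) ≤ Real.log (muConst k) := by
    rw [h3, Real.log_mul (by positivity) (by positivity), Real.log_pow]
    have : 0 ≤ Real.log (1 + phi * s) := Real.log_nonneg (by nlinarith)
    linarith
  exact (mul_le_mul_of_nonneg_right e1 log_one_div_phi_pos.le).trans e2

theorem log_muConst_le (hk : 4 < k) :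
    Real.log (muConst k) ≤ (Real.log k / Real.log 2 + 1) * Real.log (1 / phi) := by
  obtain ⟨s, h0, h1, h2, h3⟩ := muConst_of_four_lt hk
  have hφ := phi_pos
  have hl := Real.log_pos one_lt_two
  have e1 : (Nat.log 2 k : ℝ) ≤ Real.log k / Real.log 2 := by
    rw [h2, Real.log_mul (by positivity) (by positivity), Real.log_pow, le_div_iff₀ hl]
    have : 0 ≤ Real.log (1 + s) := Real.log_nonneg (by linarith)
    linarith
  have e2 : Real.log (muConst k) ≤ (Nat.log 2 k + 1) * Real.log (1 / phi) := by
    rw [h3, Real.log_mul (by positivity) (by positivity), Real.log_pow, add_mul, one_mul]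
    gcongr
    rw [one_div_phi]
    nlinarith
  exact e2.trans (mul_le_mul_of_nonneg_right (by linarith) log_one_div_phi_pos.le)

/-- Evaluate the one-variable inequality at x = φ_k: there x^k = 1 - x, so both entropies agree and
cancel. This yields z_k ≤ ψ_k. -/
theorem muConst_le (hk : 2 ≤ k) : muConst k ≤ 1 / phiConst k ^ (k - 1) := by
  have hm0 := phiConst_pos (k := k) (by omega)
  have hm1 := phiConst_lt_one k
  have hmk := phiConst_pow k
  have h := expEntropy_nat_mul_ge hk (t := -Real.log (phiConst k))
    (by linarith [Real.log_nonpos hm0.le hm1.le])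
  have e : -((k : ℝ) * -Real.log (phiConst k)) = k * Real.log (phiConst k) := by ring
  rw [expEntropy, expEntropy, neg_neg, e, Real.exp_nat_mul, Real.exp_log hm0, hmk,
    Real.binEntropy_one_sub, ← hmk, show k = k - 1 + 1 by omega, pow_succ] at h
  simp only [Nat.sub_add_cancel (show 1 ≤ k by omega)] at h
  have hb := Real.binEntropy_pos hm0 hm1
  have h2 := mul_le_mul_of_nonneg_right h (div_pos hm0 hb).le
  refine le_trans (le_of_eq ?_) (h2.trans (le_of_eq ?_)) <;> field_simp

theorem one_le_muConst (hk : 2 ≤ k) : 1 ≤ muConst k := by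
  rcases le_or_gt k 4 with h4 | h4
  · rw [muConst, if_pos h4, alphaConst, le_div_iff₀ (pow_pos (phiConst_pos (by omega)) _), one_mul]
    exact pow_le_one₀ (phiConst_pos (by omega)).le (phiConst_lt_one k).le
  · obtain ⟨s, h0, h1, h2, h3⟩ := muConst_of_four_lt h4
    have hφ := phi_pos
    rw [h3, one_div_phi]
    exact one_le_mul_of_one_le_of_one_le (one_le_pow₀ (by linarith)) (by nlinarith)

theorem zConst_eq_exp (hk : 2 ≤ k) :
    zConst k = 1 - Real.exp (-(Real.log (muConst k) / (k - 1))) := by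
  have hk1 : (2 : ℝ) ≤ k := by exact_mod_cast hk
  have h1 : (k : ℝ) - 1 ≠ 0 := by linarith
  have h2 : 1 - (k : ℝ) ≠ 0 := by linarith
  rw [zConst, Real.rpow_def_of_pos (muConst_pos hk)]
  congr 2
  rw [mul_one_div, ← neg_sub (k : ℝ) 1, div_neg]

theorem zConst_le_psiConst (hk : 2 ≤ k) : zConst k ≤ psiConst k := by
  have hm0 := phiConst_pos (k := k) (by omega)
  have hk1 : (2 : ℝ) ≤ k := by exact_mod_cast hk
  rw [zConst_eq_exp hk, sub_le_comm]
  change phiConst k ≤ _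
  have h := Real.log_le_log (muConst_pos hk) (muConst_le hk)
  rw [one_div, Real.log_inv, Real.log_pow, Nat.cast_sub (by omega), Nat.cast_one] at h
  rw [← Real.log_le_iff_le_exp hm0, le_neg, div_le_iff₀ (by linarith)]
  linarith

theorem zConst_eq_psiConst (hk : 2 ≤ k) (hk4 : k ≤ 4) : zConst k = psiConst k := by
  have hm0 := phiConst_pos (k := k) (by omega)
  have hk1 : (2 : ℝ) ≤ k := by exact_mod_cast hk
  rw [zConst_eq_exp hk, muConst, if_pos hk4, alphaConst, one_div, Real.log_inv, Real.log_pow,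
    Nat.cast_sub (by omega), Nat.cast_one, neg_div, neg_neg,
    mul_div_cancel_left₀ _ (by linarith), Real.exp_log hm0, phiConst]
  ring

theorem zConst_ge (hk : 2 ≤ k) :
    1 - 1 / (1 + Real.log (muConst k) / (k - 1)) ≤ zConst k := by
  have hk1 : (2 : ℝ) ≤ k := by exact_mod_cast hk
  rw [zConst_eq_exp hk, Real.exp_neg, one_div]
  have h0 : 0 ≤ Real.log (muConst k) / (k - 1) :=
    div_nonneg (Real.log_nonneg (one_le_muConst hk)) (by linarith)
  gcongr
  linarith [Real.add_one_le_exp (Real.log (muConst k) / (k - 1))]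

theorem zConst_le (hk : 2 ≤ k) : zConst k ≤ Real.log (muConst k) / (k - 1) := by
  rw [zConst_eq_exp hk]
  linarith [Real.add_one_le_exp (-(Real.log (muConst k) / (k - 1)))]

theorem log_div_lt_zConst (hk : 4 < k) : Real.log k / (2 * k) < zConst k := by
  have hk1 : (5 : ℝ) ≤ k := by exact_mod_cast hk
  refine lt_of_lt_of_le ?_ (zConst_ge (by omega))
  have hM := phi_mul_log_le_log_muConst hk
  have hl : 0 < Real.log k := Real.log_pos (by linarith)
  have hφ : 0.6 < phi := by rw [← phiConst_two]; exact lt_phiConst (by norm_num)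
  have hφ' : phi < 0.62 := by
    rw [← phiConst_two]; exact phiConst_lt (by norm_num) (by norm_num)
  -- A relaxed tangent line of log at 7/2, strong enough for k - 1 + φ log k < 2kφ below.
  have hup : Real.log k ≤ 5 / 4 + 2 / 7 * k := by
    have h1 := Real.log_le_sub_one_of_pos (by positivity : (0 : ℝ) < 2 / 7 * k)
    rw [Real.log_mul (by norm_num) (by linarith)] at h1
    have h2 := Real.log_le_sub_one_of_pos (by norm_num : (0 : ℝ) < 7 / 4)
    rw [show (7 : ℝ) / 4 = (2 / 7)⁻¹ / 2 by norm_num, Real.log_div (by norm_num) (by norm_num), Real.log_inv] at h2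
    linarith [Real.log_two_lt_d9]
  set l := Real.log k
  set M := Real.log (muConst k)
  have hk2 : (0 : ℝ) < k - 1 := by linarith
  have hpl : 0 < phi * l := mul_pos (by linarith) hl
  have h1 : 1 - 1 / (1 + phi * l / (k - 1)) ≤ 1 - 1 / (1 + M / (k - 1)) := by
    gcongr
  refine lt_of_lt_of_le ?_ h1
  have e : 1 - 1 / (1 + phi * l / (k - 1)) = phi * l / (k - 1 + phi * l) := by
    field_simp
    ring
  rw [e, div_lt_div_iff₀ (by linarith) (by linarith)]
  have h2 := mul_le_mul_of_nonneg_right hφ.le (by linarith : (0 : ℝ) ≤ 2 * k)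
  have h3 := mul_le_mul_of_nonneg_right hφ'.le hl.le
  have h4 : k - 1 + phi * l < phi * (2 * k) := by linarith
  nlinarith

/-- If ψ ≥ (log k)/k, then (1 - ψ)^k ≤ 1/k < (log k)/k, because log k > 1 for k ≥ 3; this
contradicts (1 - ψ)^k = ψ. -/
theorem psiConst_lt_log_div (hk : 3 ≤ k) : psiConst k < Real.log k / k := by
  have hk1 : (3 : ℝ) ≤ k := by exact_mod_cast hk
  by_contra hcon
  rw [not_lt] at hcon
  have hl : 1 < Real.log k := by
    rw [Real.lt_log_iff_exp_lt (by linarith)]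
    linarith [Real.exp_one_lt_d9]
  have h1 : (1 - psiConst k) ^ k ≤ Real.exp (-(Real.log k / k)) ^ k := by
    refine pow_le_pow_left₀ (by linarith [(psiConst_spec k).1.2]) ?_ k
    linarith [Real.add_one_le_exp (-(Real.log k / k))]
  rw [← Real.exp_nat_mul, mul_neg, mul_div_cancel₀ _ (by linarith : (k : ℝ) ≠ 0), Real.exp_neg,
    Real.exp_log (by linarith)] at h1
  have h2 : (k : ℝ)⁻¹ < Real.log k / k := by
    rw [← one_div]
    gcongr
  linarith [(psiConst_spec k).2]

/-- Feed the upper bound back into k log(1 - ψ) = log ψ: this gives -k log(1 - ψ) ≥ log k - log log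
k, while (1 - ψ)(-log(1 - ψ)) ≤ ψ. -/
theorem psiConst_ge (hk : 3 ≤ k) :
    (1 - Real.log k / k) * (Real.log k - Real.log (Real.log k)) ≤ k * psiConst k := by
  have hk1 : (3 : ℝ) ≤ k := by exact_mod_cast hk
  have hlt := psiConst_lt_log_div hk
  have hp := psiConst_pos (k := k)
  have hp1 := psiConst_lt_one (k := k) (by omega)
  have hl : 0 < Real.log k := Real.log_pos (by linarith)
  have h1 : Real.log (psiConst k) = k * Real.log (1 - psiConst k) := by
    rw [← Real.log_pow]
    congr 1
    linarith [(psiConst_spec k).2]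
  have h2 := Real.log_le_log hp hlt.le
  rw [Real.log_div hl.ne' (by linarith)] at h2
  have h3 := Real.log_le_sub_one_of_pos (inv_pos.2 (by linarith : 0 < 1 - psiConst k))
  rw [Real.log_inv] at h3
  have h4 : (1 - psiConst k) * -Real.log (1 - psiConst k) ≤ psiConst k := by
    have := mul_le_mul_of_nonneg_left h3 (by linarith : 0 ≤ 1 - psiConst k)
    rw [mul_sub, mul_inv_cancel₀ (by linarith)] at this
    linarith
  have h5 : Real.log (Real.log k) ≤ Real.log k := (Real.log_le_sub_one_of_pos hl).trans (by linarith)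
  calc (1 - Real.log k / k) * (Real.log k - Real.log (Real.log k))
      ≤ (1 - psiConst k) * (Real.log k - Real.log (Real.log k)) := by
        gcongr
    _ ≤ (1 - psiConst k) * (k * -Real.log (1 - psiConst k)) := by
        gcongr
        linarith
    _ = k * ((1 - psiConst k) * -Real.log (1 - psiConst k)) := by ring
    _ ≤ _ := by gcongr

theorem zConst_bounds (hk : 2 ≤ k) : Real.log k / (3 * k) < zConst k ∧
    1 / 2 < zConst k / psiConst k ∧ zConst k / psiConst k ≤ 1 := by
  have hp := psiConst_pos (k := k)
  refine ⟨?_, ?_, (div_le_one hp).2 (zConst_le_psiConst hk)⟩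
  · rcases le_or_gt k 4 with h4 | h4
    · have hk1 : (2 : ℝ) ≤ k := by exact_mod_cast hk
      rw [zConst_eq_psiConst hk h4]
      have h1 : phiConst k < 3 / 4 := by
        refine phiConst_lt (by norm_num) ?_
        calc (1 : ℝ) - 3 / 4 < (3 / 4) ^ 4 := by norm_num
          _ ≤ (3 / 4) ^ k := pow_le_pow_of_le_one (by norm_num) (by norm_num) h4
      have h2 : Real.log k ≤ k - 1 := Real.log_le_sub_one_of_pos (by linarith)
      have h3 : (k : ℝ) ≤ 4 := by exact_mod_cast h4
      rw [div_lt_iff₀ (by linarith)]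
      rw [phiConst] at h1
      nlinarith
    · refine lt_of_le_of_lt ?_ (log_div_lt_zConst h4)
      have hk1 : (5 : ℝ) ≤ k := by exact_mod_cast h4
      have hl : 0 < Real.log k := Real.log_pos (by linarith)
      gcongr
      norm_num
  · rcases le_or_gt k 4 with h4 | h4
    · rw [zConst_eq_psiConst hk h4, div_self hp.ne']
      norm_num
    · rw [lt_div_iff₀ hp]
      have h1 := log_div_lt_zConst h4
      have h2 := psiConst_lt_log_div (k := k) (by omega)
      have : Real.log k / (2 * k) = 1 / 2 * (Real.log k / k) := by ring
      linarith

end LogMu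

/-! ### Asymptotics of z_k / ψ_k and the numerical value of the limit. -/

theorem tendsto_log_div_natCast : Tendsto (fun k : ℕ => Real.log k / k) atTop (𝓝 0) :=
  Real.isLittleO_log_id_atTop.tendsto_div_nhds_zero.comp tendsto_natCast_atTop_atTop

theorem tendsto_log_natCast : Tendsto (fun k : ℕ => Real.log k) atTop atTop :=
  Real.tendsto_log_atTop.comp tendsto_natCast_atTop_atTop

theorem tendsto_mul_psiConst_div_log :
    Tendsto (fun k : ℕ => k * psiConst k / Real.log k) atTop (𝓝 1) := by
  have h1 : Tendsto (fun k : ℕ => (1 - Real.log k / k) *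
      (1 - Real.log (Real.log k) / Real.log k)) atTop (𝓝 1) := by
    have h2 := (Real.isLittleO_log_id_atTop.tendsto_div_nhds_zero).comp tendsto_log_natCast
    have := (tendsto_log_div_natCast.const_sub 1).mul (h2.const_sub 1)
    simpa using this
  refine tendsto_of_tendsto_of_tendsto_of_le_of_le' h1 tendsto_const_nhds ?_ ?_
  all_goals
    filter_upwards [eventually_ge_atTop 3] with k hk
    have hk1 : (3 : ℝ) ≤ k := by exact_mod_cast hk
    have hl : 0 < Real.log k := Real.log_pos (by linarith)
  · rw [le_div_iff₀ hl]
    refine le_trans (le_of_eq ?_) (psiConst_ge hk)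
    field_simp
  · rw [div_le_one hl, mul_comm, ← le_div_iff₀ (by linarith)]
    exact (psiConst_lt_log_div hk).le

theorem tendsto_log_muConst_div_log :
    Tendsto (fun k : ℕ => Real.log (muConst k) / Real.log k) atTop
      (𝓝 (Real.log (1 / phi) / Real.log 2)) := by
  have h0 : Tendsto (fun k : ℕ => Real.log (1 / phi) / Real.log k) atTop (𝓝 0) :=
    tendsto_log_natCast.const_div_atTop _
  have h1 := h0.const_sub (Real.log (1 / phi) / Real.log 2)
  have h2 := h0.const_add (Real.log (1 / phi) / Real.log 2)
  rw [sub_zero] at h1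
  rw [add_zero] at h2
  have hl2 := Real.log_pos one_lt_two
  refine tendsto_of_tendsto_of_tendsto_of_le_of_le' h1 h2 ?_ ?_
  all_goals
    filter_upwards [eventually_gt_atTop 4] with k hk
    have hk1 : (5 : ℝ) ≤ k := by exact_mod_cast hk
    have hl : 0 < Real.log k := Real.log_pos (by linarith)
  · rw [le_div_iff₀ hl]
    refine le_trans (le_of_eq ?_) (log_muConst_ge hk)
    field_simp
  · rw [div_le_iff₀ hl]
    refine (log_muConst_le hk).trans (le_of_eq ?_)
    field_simp

theorem tendsto_mul_zConst_div_log :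
    Tendsto (fun k : ℕ => k * zConst k / Real.log k) atTop
      (𝓝 (Real.log (1 / phi) / Real.log 2)) := by
  have hr : Tendsto (fun k : ℕ => (k : ℝ) / (k - 1)) atTop (𝓝 1) := by
    have h2 : Tendsto (fun k : ℕ => 1 / (1 - (k : ℝ)⁻¹)) atTop (𝓝 1) := by
      have := ((tendsto_inv_atTop_nhds_zero_nat (𝕜 := ℝ)).const_sub 1).inv₀ (by norm_num)
      simpa using this
    refine h2.congr' ?_
    filter_upwards [eventually_gt_atTop 1] with k hk
    have hk1 : (1 : ℝ) < k := by exact_mod_cast hk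
    have : (k : ℝ) - 1 ≠ 0 := by linarith
    field_simp
  have hup := tendsto_log_muConst_div_log.mul hr
  have hL : Tendsto (fun k : ℕ => Real.log (muConst k) / (k - 1)) atTop (𝓝 0) := by
    have := hup.mul tendsto_log_div_natCast
    rw [mul_zero] at this
    refine this.congr' ?_
    filter_upwards [eventually_gt_atTop 1] with k hk
    have hk1 : (1 : ℝ) < k := by exact_mod_cast hk
    have hl : 0 < Real.log k := Real.log_pos (by linarith)
    have : (k : ℝ) - 1 ≠ 0 := by linarith
    field_simp
  have hlow := hup.mul ((hL.const_add 1).inv₀ (by norm_num))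
  simp only [mul_one, add_zero, inv_one] at hlow hup
  refine tendsto_of_tendsto_of_tendsto_of_le_of_le' hlow hup ?_ ?_
  all_goals
    filter_upwards [eventually_gt_atTop 1] with k hk
    have hk1 : (1 : ℝ) < k := by exact_mod_cast hk
    have hl : 0 < Real.log k := Real.log_pos (by linarith)
    have hk2 : (0 : ℝ) < k - 1 := by linarith
    have hM := Real.log_nonneg (one_le_muConst hk)
  · have h := mul_le_mul_of_nonneg_left (zConst_ge hk) (by positivity : 0 ≤ k / Real.log k)
    refine le_trans (le_of_eq ?_) (h.trans (le_of_eq ?_))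
    · have : (k : ℝ) - 1 + Real.log (muConst k) ≠ 0 := by positivity
      field_simp
      ring
    · ring
  · have h := mul_le_mul_of_nonneg_left (zConst_le hk) (by positivity : 0 ≤ k / Real.log k)
    refine le_trans (le_of_eq ?_) (h.trans (le_of_eq ?_)) <;> ring

theorem tendsto_zConst_div_psiConst :
    Tendsto (fun k : ℕ => zConst k / psiConst k) atTop
      (𝓝 (Real.log (1 / phi) / Real.log 2)) := by
  have h := tendsto_mul_zConst_div_log.div tendsto_mul_psiConst_div_log one_ne_zero
  rw [div_one] at h
  refine h.congr' ?_
  filter_upwards [eventually_gt_atTop 1] with k hk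
  have hk1 : (1 : ℝ) < k := by exact_mod_cast hk
  have hl : 0 < Real.log k := Real.log_pos (by linarith)
  have := (psiConst_pos (k := k)).ne'
  simp only [Pi.div_apply]
  field_simp

theorem abs_log_one_div_phi_div_log_two_sub_lt :
    |Real.log (1 / phi) / Real.log 2 - 0.6943| < 0.0001 := by
  have hl := Real.log_pos one_lt_two
  have h1 : 0.61803 < phi := by
    rw [← phiConst_two]; exact lt_phiConst (by norm_num)
  have h2 : phi < 0.61804 := by
    rw [← phiConst_two]; exact phiConst_lt (by norm_num) (by norm_num)
  -- The fractions 84/121 and 109/157 enclose the limit and lie within 10^(-4) of 0.6943; comparing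
  -- logarithms becomes comparing integer powers.
  have h3 : 84 * Real.log 2 < 121 * Real.log (1 / phi) := by
    have : (2 : ℝ) ^ 84 < (1 / phi) ^ 121 := by
      rw [one_div_phi]
      calc (2 : ℝ) ^ 84 < (1 + 0.61803) ^ 121 := by norm_num
        _ ≤ (1 + phi) ^ 121 := by gcongr
    have h := Real.log_lt_log (by positivity) this
    rw [Real.log_pow, Real.log_pow] at h
    exact_mod_cast h
  have h4 : 157 * Real.log (1 / phi) < 109 * Real.log 2 := by
    have : (1 / phi) ^ 157 < (2 : ℝ) ^ 109 := by
      rw [one_div_phi]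
      calc (1 + phi) ^ 157 ≤ (1 + 0.61804) ^ 157 := by
            have := phi_pos
            gcongr
        _ < (2 : ℝ) ^ 109 := by norm_num
    have h := Real.log_lt_log (pow_pos (one_div_pos.2 phi_pos) _) this
    rw [Real.log_pow, Real.log_pow] at h
    exact_mod_cast h
  have h5 : 84 / 121 < Real.log (1 / phi) / Real.log 2 := by
    rw [lt_div_iff₀ hl]; linarith
  have h6 : Real.log (1 / phi) / Real.log 2 < 109 / 157 := by
    rw [div_lt_iff₀ hl]; linarith
  rw [abs_lt]
  constructor <;> norm_num at * <;> linarith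

/-! ### Entropy of keys on a finite set, by counting fibers. -/

section Counting

variable {α β γ : Type*} [DecidableEq β] [DecidableEq γ]

/-- The number of elements of `S` with the same key as `a`. -/
def fiberCard (S : Finset α) (κ : α → β) (a : α) : ℕ := (S.filter fun b => κ b = κ a).card

/-- The proportion of elements satisfying `P` among those of `S` with the same key as `a`. -/
noncomputable def condFreq (S : Finset α) (κ : α → β) (P : α → Prop) [DecidablePred P] (a : α) :
    ℝ :=
  (((S.filter fun b => κ b = κ a).filter P).card : ℝ) / (S.filter fun b => κ b = κ a).card

/-- `|S| log |S|` minus `|S|` times the entropy of the key of a uniform element of `S`. -/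
noncomputable def logFiberSum (S : Finset α) (κ : α → β) : ℝ :=
  ∑ a ∈ S, Real.log (fiberCard S κ a)

theorem sum_eq_sum_image_fiber (S : Finset α) (κ : α → β) (f : α → ℝ) :
    ∑ a ∈ S, f a = ∑ v ∈ S.image κ, ∑ a ∈ S.filter (fun b => κ b = v), f a :=
  (sum_fiberwise_of_maps_to (fun _ h => mem_image_of_mem κ h) f).symm

variable (S : Finset α) (κ : α → β) (P : α → Prop) [DecidablePred P]

theorem fiberCard_pos {a : α} (ha : a ∈ S) : (0 : ℝ) < fiberCard S κ a :=
  Nat.cast_pos.2 (card_pos.2 ⟨a, mem_filter.2 ⟨ha, rfl⟩⟩)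

theorem condFreq_nonneg (a : α) : 0 ≤ condFreq S κ P a := by
  unfold condFreq; positivity

theorem condFreq_le_one (a : α) : condFreq S κ P a ≤ 1 :=
  div_le_one_of_le₀ (by exact_mod_cast card_filter_le _ _) (by positivity)

theorem sum_condFreq : ∑ a ∈ S, condFreq S κ P a = (S.filter P).card := by
  have e : ((S.filter P).card : ℝ) = ∑ a ∈ S, if P a then (1 : ℝ) else 0 := by simp
  rw [e, sum_eq_sum_image_fiber S κ, sum_eq_sum_image_fiber S κ]
  refine sum_congr rfl fun v hv => ?_
  obtain ⟨a, ha, rfl⟩ := mem_image.1 hv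
  have h1 : ∀ b ∈ S.filter (fun b => κ b = κ a), condFreq S κ P b = condFreq S κ P a := by
    intro b hb
    rw [condFreq, condFreq, (mem_filter.1 hb).2]
  have h2 : ((S.filter fun b => κ b = κ a).card : ℝ) ≠ 0 :=
    (fiberCard_pos S κ ha).ne'
  rw [sum_congr rfl h1, sum_const, nsmul_eq_mul, condFreq, mul_div_cancel₀ _ h2]
  simp

theorem mul_binEntropy_div {c d : ℝ} (hc : 0 < c) (hd : 0 ≤ d) (hdc : d ≤ c) :
    c * Real.binEntropy (d / c) =
      c * Real.log c - d * Real.log d - (c - d) * Real.log (c - d) := by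
  have e : 1 - d / c = (c - d) / c := by field_simp
  rw [Real.binEntropy, e, Real.log_inv, Real.log_inv]
  rcases hd.eq_or_lt with rfl | hd
  · simp
  rcases hdc.eq_or_lt with rfl | hdc
  · simp [hc.ne']
  rw [Real.log_div hd.ne' hc.ne', Real.log_div (by linarith) hc.ne']
  field_simp
  ring

/-- Chain rule: refining the key by `P` gains the average binary entropy of `P` given the key. -/
theorem logFiberSum_sub {κ' : α → γ}
    (h : ∀ a ∈ S, ∀ b ∈ S, κ' a = κ' b ↔ κ a = κ b ∧ (P a ↔ P b)) :
    logFiberSum S κ - logFiberSum S κ' = ∑ a ∈ S, Real.binEntropy (condFreq S κ P a) := by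
  rw [logFiberSum, logFiberSum, ← sum_sub_distrib, sum_eq_sum_image_fiber S κ,
    sum_eq_sum_image_fiber S κ fun a => Real.binEntropy _]
  refine sum_congr rfl fun v hv => ?_
  obtain ⟨a, ha, rfl⟩ := mem_image.1 hv
  set T := S.filter (fun b => κ b = κ a) with hT
  have h1 : ∀ b ∈ T, Real.binEntropy (condFreq S κ P b) =
      Real.binEntropy ((T.filter P).card / T.card) := by
    intro b hb
    rw [condFreq, (mem_filter.1 hb).2]
  have hsum : ((T.filter P).card : ℝ) + (T.filter fun b => ¬ P b).card = T.card := by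
    exact_mod_cast card_filter_add_card_filter_not P
  have h2 : ∀ b ∈ T, Real.log (fiberCard S κ b) - Real.log (fiberCard S κ' b) =
      Real.log T.card - if P b then Real.log (T.filter P).card
        else Real.log (T.filter fun b => ¬ P b).card := by
    intro b hb
    have hbS := mem_filter.1 hb
    -- The finer key splits the fiber T into its P part and its non-P part, and `mul_binEntropy_div`
    -- is the entropy of that split.
    have e1 : S.filter (fun b' => κ' b' = κ' b) = T.filter fun b' => P b' ↔ P b := by
      rw [hT, filter_filter]
      refine filter_congr fun b' hb' => ?_
      rw [h b' hb' b hbS.1, hbS.2]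
    rw [fiberCard, fiberCard, hbS.2, e1]
    split_ifs with hP <;> simp [hP, hT]
  have hTpos : (0 : ℝ) < T.card := fiberCard_pos S _ ha
  have hle : ((T.filter P).card : ℝ) ≤ T.card := by exact_mod_cast card_filter_le _ _
  rw [sum_congr rfl h1, sum_congr rfl h2, sum_const, nsmul_eq_mul,
    mul_binEntropy_div hTpos (by positivity) hle, sum_sub_distrib, sum_const, nsmul_eq_mul, sum_ite,
    sum_const, sum_const, nsmul_eq_mul, nsmul_eq_mul, ← hsum, add_sub_cancel_left]
  ring

/-- Conditioning on a finer key decreases the average binary entropy. -/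
theorem sum_binEntropy_condFreq_le {ρ : α → γ}
    (h : ∀ a ∈ S, ∀ b ∈ S, κ a = κ b → ρ a = ρ b) :
    ∑ a ∈ S, Real.binEntropy (condFreq S κ P a) ≤
      ∑ a ∈ S, Real.binEntropy (condFreq S ρ P a) := by
  rw [sum_eq_sum_image_fiber S ρ, sum_eq_sum_image_fiber S ρ]
  refine sum_le_sum fun v hv => ?_
  obtain ⟨a, ha, rfl⟩ := mem_image.1 hv
  set T := S.filter (fun b => ρ b = ρ a) with hT
  have hTpos : (0 : ℝ) < T.card := fiberCard_pos S _ ha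
  have h1 : ∀ b ∈ T, Real.binEntropy (condFreq S ρ P b) =
      Real.binEntropy ((T.filter P).card / T.card) := by
    intro b hb
    rw [condFreq, (mem_filter.1 hb).2]
  have h2 : ∀ b ∈ T, condFreq S κ P b = condFreq T κ P b := by
    intro b hb
    have hbS := mem_filter.1 hb
    have : S.filter (fun b' => κ b' = κ b) = T.filter (fun b' => κ b' = κ b) := by
      rw [hT, filter_filter]
      refine filter_congr fun b' hb' => ⟨fun hk => ⟨?_, hk⟩, fun hk => hk.2⟩
      rw [h b' hb' b hbS.1 hk, hbS.2]
    rw [condFreq, condFreq, this]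
  -- Within a coarse fiber the fine frequencies average to the coarse one, so Jensen applies.
  have h3 := Real.strictConcave_binEntropy.concaveOn.le_map_sum (t := T)
    (w := fun _ => 1 / (T.card : ℝ)) (p := fun b => condFreq T κ P b)
    (fun _ _ => by positivity) (by simp [hTpos.ne'])
    (fun b _ => ⟨condFreq_nonneg T κ P b, condFreq_le_one T κ P b⟩)
  simp only [smul_eq_mul, ← mul_sum] at h3
  rw [sum_condFreq, one_div_mul_eq_div, one_div_mul_eq_div, div_le_iff₀ hTpos] at h3
  rw [sum_congr rfl h1, sum_const, nsmul_eq_mul, sum_congr rfl fun b hb => by rw [h2 b hb]]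
  linarith

/-- A key taking at most `N` values on `S` has entropy at most `log N`. -/
theorem logFiberSum_ge {N : ℝ} (hN : 0 < N) (h : ((S.image κ).card : ℝ) ≤ N) :
    S.card * (Real.log S.card - Real.log N) ≤ logFiberSum S κ := by
  rcases S.eq_empty_or_nonempty with rfl | hS
  · simp [logFiberSum]
  have hc : (0 : ℝ) < S.card := by exact_mod_cast card_pos.2 hS
  have hpos : ∀ a ∈ S, (0 : ℝ) < fiberCard S κ a := fun a ha => fiberCard_pos S κ ha
  have h1 : ∑ a ∈ S, (1 : ℝ) / fiberCard S κ a = (S.image κ).card := by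
    rw [sum_eq_sum_image_fiber S κ, card_eq_sum_ones, Nat.cast_sum]
    refine sum_congr rfl fun v hv => ?_
    obtain ⟨a, ha, rfl⟩ := mem_image.1 hv
    have h2 : ∀ b ∈ S.filter (fun b => κ b = κ a),
        (1 : ℝ) / fiberCard S κ b = 1 / fiberCard S κ a := by
      intro b hb
      rw [fiberCard, fiberCard, (mem_filter.1 hb).2]
    rw [sum_congr rfl h2, sum_const, nsmul_eq_mul, ← fiberCard,
      mul_one_div_cancel (hpos a ha).ne', Nat.cast_one]
  -- Gibbs' inequality from log u ≤ u - 1; summing 1 / (fiber size) over S counts the keys.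
  have h2 : ∀ a ∈ S, (1 - S.card / N * (1 / fiberCard S κ a)) ≤
      Real.log (fiberCard S κ a) - (Real.log S.card - Real.log N) := by
    intro a ha
    have hp := hpos a ha
    have := Real.log_le_sub_one_of_pos (by positivity : 0 < S.card / N * (1 / fiberCard S κ a))
    rw [Real.log_mul (by positivity) (by positivity), Real.log_div hc.ne' hN.ne', one_div,
      Real.log_inv] at this
    rw [one_div]
    linarith
  have h3 := sum_le_sum h2
  rw [sum_sub_distrib, sum_sub_distrib, ← mul_sum, h1, sum_const, sum_const, nsmul_eq_mul,
    nsmul_eq_mul, ← logFiberSum] at h3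
  have h4 : (S.card : ℝ) / N * (S.image κ).card ≤ S.card := by
    rw [div_mul_eq_mul_div, div_le_iff₀ hN]
    gcongr
  linarith

theorem logFiberSum_mono {T : Finset α} (h : T ⊆ S) : logFiberSum T κ ≤ logFiberSum S κ := by
  refine (sum_le_sum fun a ha => ?_).trans (sum_le_sum_of_subset_of_nonneg h fun a ha _ => ?_)
  · refine Real.log_le_log (fiberCard_pos T κ ha) ?_
    exact_mod_cast card_le_card (filter_subset_filter _ h)
  · exact Real.log_natCast_nonneg _

end Counting

/-! ### Entropy of the union of k uniform members. -/

section Union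

variable {n : ℕ}

/-- The elements of `A` below `i`. -/
def initialPart (i : ℕ) (A : Finset (Fin n)) : Finset (Fin n) := A.filter fun j => (j : ℕ) < i

theorem initialPart_succ_eq_iff (i : Fin n) (A B : Finset (Fin n)) :
    initialPart (i + 1) A = initialPart (i + 1) B ↔
      initialPart i A = initialPart i B ∧ (i ∉ A ↔ i ∉ B) := by
  simp only [initialPart, Finset.ext_iff, mem_filter]
  constructor
  · refine fun h => ⟨fun j => ?_, ?_⟩
    · have := h j
      constructor <;> rintro ⟨h1, h2⟩
      · exact ⟨(this.1 ⟨h1, by omega⟩).1, h2⟩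
      · exact ⟨(this.2 ⟨h1, by omega⟩).1, h2⟩
    · have := h i
      simp only [Nat.lt_succ_self, and_true] at this
      rw [this]
  · rintro ⟨h1, h2⟩ j
    rcases lt_trichotomy (j : ℕ) i with hj | hj | hj
    · have := h1 j
      have : (j : ℕ) < i + 1 := by omega
      simp_all
    · obtain rfl : j = i := Fin.ext hj
      have := not_iff_not.1 h2
      simp_all
    · have : ¬ (j : ℕ) < i + 1 := by omega
      simp [this]

theorem initialPart_zero (A : Finset (Fin n)) : initialPart 0 A = ∅ := by simp [initialPart]

theorem initialPart_self (A : Finset (Fin n)) : initialPart n A = A := by simp [initialPart]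

theorem logFiberSum_const {α β : Type*} [DecidableEq β] (S : Finset α) (b : β) :
    logFiberSum S (fun _ => b) = S.card * Real.log S.card := by
  simp [logFiberSum, fiberCard]

theorem logFiberSum_id {α : Type*} [DecidableEq α] (S : Finset α) :
    logFiberSum S (fun a => a) = 0 := by
  refine sum_eq_zero fun a ha => ?_
  have : S.filter (fun b => b = a) = {a} := by
    ext b
    simp only [mem_filter, mem_singleton]
    exact ⟨fun h => h.2, fun h => ⟨h ▸ ha, h⟩⟩
  simp [fiberCard, this]

/-- The entropy of a uniform member of `F`, by the chain rule. -/
theorem sum_sum_binEntropy_condFreq (F : Finset (Finset (Fin n))) :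
    ∑ i : Fin n, ∑ A ∈ F, Real.binEntropy (condFreq F (initialPart i) (fun A => i ∉ A) A) =
      F.card * Real.log F.card := by
  have h : ∀ i : Fin n,
      ∑ A ∈ F, Real.binEntropy (condFreq F (initialPart i) (fun A => i ∉ A) A) =
      logFiberSum F (initialPart i) - logFiberSum F (initialPart (i + 1)) := fun i =>
    (logFiberSum_sub F _ _ fun A _ B _ => initialPart_succ_eq_iff i A B).symm
  rw [sum_congr rfl fun i _ => h i,
    Fin.sum_univ_eq_sum_range (fun i => logFiberSum F (initialPart i) -
      logFiberSum F (initialPart (n := n) (i + 1))) n, sum_range_sub']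
  have h0 : initialPart (n := n) 0 = fun _ => ∅ := funext initialPart_zero
  have h1 : initialPart (n := n) n = fun A => A := funext initialPart_self
  rw [h0, h1, logFiberSum_const, logFiberSum_id, sub_zero]

variable {k : ℕ}

/-- Independence of the coordinates: fixing all prefixes leaves a product of fibers, and the union
misses i exactly when every coordinate does. -/
theorem condFreq_piFinset (F : Finset (Finset (Fin n))) (i : Fin n)
    (A : Fin k → Finset (Fin n)) :
    condFreq (Fintype.piFinset fun _ : Fin k => F) (fun A j => initialPart i (A j))
      (fun A => i ∉ univ.biUnion A) A =
    ∏ j, condFreq F (initialPart i) (fun A => i ∉ A) (A j) := by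
  have h1 : ((Fintype.piFinset fun _ : Fin k => F).filter
      fun B => (fun j => initialPart i (B j)) = fun j => initialPart i (A j)) =
      Fintype.piFinset fun j => F.filter fun B => initialPart i B = initialPart i (A j) := by
    ext B
    simp only [mem_filter, Fintype.mem_piFinset, funext_iff, forall_and]
  have h2 : ((Fintype.piFinset fun j => F.filter
      fun B => initialPart i B = initialPart i (A j)).filter fun B => i ∉ univ.biUnion B) =
      Fintype.piFinset fun j => (F.filter fun B => initialPart i B = initialPart i (A j)).filter
        fun B => i ∉ B := by
    ext B
    simp only [mem_filter, Fintype.mem_piFinset, mem_biUnion, mem_univ, true_and, not_exists,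
      forall_and]
  rw [condFreq, h1, h2, Fintype.card_piFinset, Fintype.card_piFinset, Nat.cast_prod,
    Nat.cast_prod, ← prod_div_distrib]
  rfl

theorem sum_piFinset_mul_prod_erase {α : Type*} (F : Finset α) (g f : α → ℝ) :
    ∑ A ∈ Fintype.piFinset (fun _ : Fin k => F), ∑ l, g (A l) * ∏ j ∈ univ.erase l, f (A j) =
      k * ((∑ a ∈ F, g a) * (∑ a ∈ F, f a) ^ (k - 1)) := by
  classical
  rw [sum_comm]
  have h : ∀ l : Fin k, ∑ A ∈ Fintype.piFinset (fun _ : Fin k => F),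
      g (A l) * ∏ j ∈ univ.erase l, f (A j) = (∑ a ∈ F, g a) * (∑ a ∈ F, f a) ^ (k - 1) := by
    intro l
    have e : ∀ A : Fin k → α, g (A l) * ∏ j ∈ univ.erase l, f (A j) =
        ∏ j, (if j = l then g else f) (A j) := by
      intro A
      rw [← mul_prod_erase univ _ (mem_univ l), if_pos rfl]
      congr 1
      refine prod_congr rfl fun j hj => ?_
      rw [if_neg (ne_of_mem_erase hj)]
    rw [sum_congr rfl fun A _ => e A,
      sum_prod_piFinset F (fun (j : Fin k) a => (if j = l then g else f) a),
      ← mul_prod_erase univ _ (mem_univ l), if_pos rfl]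
    congr 1
    rw [prod_congr rfl fun j hj => by rw [if_neg (ne_of_mem_erase hj)], prod_const,
      card_erase_of_mem (mem_univ l), card_univ, Fintype.card_fin]
  rw [sum_congr rfl fun l _ => h l, sum_const, card_univ, Fintype.card_fin, nsmul_eq_mul]

/-- The entropy of the union of `k` uniform members of `F` grows by at least the factor
`μ_k (r |F|) ^ (k - 1)` if every point is missed by at least `r |F|` members. -/
theorem logFiberSum_union_le (hk : 2 ≤ k) (F : Finset (Finset (Fin n))) {r : ℝ} (hr : 0 ≤ r)
    (hF : ∀ i : Fin n, r ≤ (F.filter fun A => i ∉ A).card) :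
    muConst k * r ^ (k - 1) * (F.card * Real.log F.card) ≤
      F.card ^ k * (k * Real.log F.card) -
        logFiberSum (Fintype.piFinset fun _ : Fin k => F) (fun A => univ.biUnion A) := by
  set S := Fintype.piFinset fun _ : Fin k => F with hS
  set ρ : ℕ → (Fin k → Finset (Fin n)) → Finset (Fin n) :=
    fun i A => initialPart i (univ.biUnion A) with hρ
  have hμ := muConst_pos hk
  have hk0 : (0 : ℝ) < k := by exact_mod_cast (by omega : 0 < k)
  -- The contribution of point i. Replacing the prefix of the union by the k separate prefixes
  -- refines the key and lowers the entropy; `binEntropy_prod_ge` then applies, and its sum over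
  -- tuples factors. The factor r^(k-1) appears because the frequencies of missing i sum to the
  -- number of members missing i.
  have hstep : ∀ i : Fin n, muConst k * r ^ (k - 1) *
      ∑ A ∈ F, Real.binEntropy (condFreq F (initialPart i) (fun A => i ∉ A) A) ≤
      logFiberSum S (ρ i) - logFiberSum S (ρ (i + 1)) := by
    intro i
    rw [logFiberSum_sub S (ρ i) (fun A => i ∉ univ.biUnion A)
      fun A _ B _ => initialPart_succ_eq_iff i _ _]
    refine le_trans ?_ (sum_binEntropy_condFreq_le S (fun A j => initialPart i (A j)) _
      fun A _ B _ h => ?_)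
    · have h1 := sum_le_sum fun A (_ : A ∈ S) => binEntropy_prod_ge hk
        (fun j => condFreq_nonneg F (initialPart i) (fun A => i ∉ A) (A j))
        (fun j => condFreq_le_one F (initialPart i) (fun A => i ∉ A) (A j))
      rw [← mul_sum, sum_piFinset_mul_prod_erase F
        (fun A => Real.binEntropy (condFreq F (initialPart i) (fun A => i ∉ A) A)),
        sum_condFreq] at h1
      rw [sum_congr rfl fun A (_ : A ∈ S) =>
        congrArg Real.binEntropy (condFreq_piFinset F i A)]
      refine le_trans ?_ h1
      have h2 : 0 ≤ ∑ A ∈ F, Real.binEntropy (condFreq F (initialPart i) (fun A => i ∉ A) A) :=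
        sum_nonneg fun A _ => Real.binEntropy_nonneg (condFreq_nonneg _ _ _ _)
          (condFreq_le_one _ _ _ _)
      have h3 := pow_le_pow_left₀ hr (hF i) (k - 1)
      have h4 := mul_le_mul_of_nonneg_left (mul_le_mul_of_nonneg_right h3 h2) hμ.le
      refine le_trans (le_of_eq ?_) (h4.trans (le_of_eq ?_))
      · ring
      · field_simp
    · simp only [hρ, funext_iff, initialPart, Finset.ext_iff, mem_filter, mem_biUnion, mem_univ,
        true_and] at h ⊢
      exact fun a => by
        constructor <;> rintro ⟨⟨j, hj⟩, ha⟩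
        · exact ⟨⟨j, ((h j a).1 ⟨hj, ha⟩).1⟩, ha⟩
        · exact ⟨⟨j, ((h j a).2 ⟨hj, ha⟩).1⟩, ha⟩
  have h := sum_le_sum fun i (_ : i ∈ univ) => hstep i
  rw [← mul_sum, sum_sum_binEntropy_condFreq,
    Fin.sum_univ_eq_sum_range (fun i => logFiberSum S (ρ i) - logFiberSum S (ρ (i + 1))) n,
    sum_range_sub'] at h
  have h0 : ρ 0 = fun _ => ∅ := funext fun A => initialPart_zero _
  have h1 : ρ n = fun A => univ.biUnion A := funext fun A => initialPart_self _
  rw [h0, h1, logFiberSum_const, hS, Fintype.card_piFinset_const, Nat.cast_pow, Real.log_pow] at h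
  exact h

/-- If most unions lie in `F`, the union of `k` uniform members has entropy close to `log |F|`. -/
theorem logFiberSum_union_ge {F : Finset (Finset (Fin n))} (hF : F.Nonempty) (hk : 1 ≤ k) {ε : ℝ}
    (hε : ε < 1) (h : IsApproxUnionClosed k (1 - ε) F) :
    F.card ^ k * (k * Real.log F.card) -
        logFiberSum (Fintype.piFinset fun _ : Fin k => F) (fun A => univ.biUnion A) ≤
      F.card ^ k * (Real.log F.card * (1 + (k - 1) * ε) + ε) := by
  rw [IsApproxUnionClosed, Fintype.card_piFinset_const, Nat.cast_pow] at h
  have h1 := logFiberSum_mono _ (fun A : Fin k → Finset (Fin n) => univ.biUnion A)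
    (filter_subset (fun A : Fin k → Finset (Fin n) => univ.biUnion A ∈ F)
      (Fintype.piFinset fun _ => F))
  have hN : (0 : ℝ) < F.card := by exact_mod_cast card_pos.2 hF
  have hN1 : (1 : ℝ) ≤ F.card := by exact_mod_cast card_pos.2 hF
  have hL : 0 ≤ Real.log F.card := Real.log_nonneg hN1
  have hk1 : (1 : ℝ) ≤ k := by exact_mod_cast hk
  set G := (Fintype.piFinset fun _ : Fin k => F).filter fun A => univ.biUnion A ∈ F
  have hK : (0 : ℝ) < (F.card : ℝ) ^ k := by positivity
  -- On the tuples with union in F the union takes at most |F| values. The other tuples contribute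
  -- nonnegatively to `logFiberSum` and were dropped.
  have h2 := logFiberSum_ge G (fun A : Fin k → Finset (Fin n) => univ.biUnion A) hN
    (by
      refine Nat.cast_le.2 (card_le_card fun B hB => ?_)
      obtain ⟨A, hA, rfl⟩ := mem_image.1 hB
      exact (mem_filter.1 hA).2)
  obtain ⟨g, hg⟩ : ∃ g : ℝ, (G.card : ℝ) = F.card ^ k * g :=
    ⟨G.card / F.card ^ k, by field_simp⟩
  rw [hg] at h h2
  have hg1 : 1 - ε ≤ g := by
    rw [mul_comm] at h
    exact le_of_mul_le_mul_left h hK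
  have hg0 : 0 < g := by linarith
  rw [Real.log_mul hK.ne' hg0.ne', Real.log_pow] at h2
  have h3 := Real.log_le_sub_one_of_pos (inv_pos.2 hg0)
  rw [Real.log_inv] at h3
  have h4 : g * -Real.log g ≤ 1 - g := by
    refine (mul_le_mul_of_nonneg_left h3 hg0.le).trans (le_of_eq ?_)
    field_simp
  have h5 : k * Real.log F.card - g * (k * Real.log F.card + Real.log g - Real.log F.card) ≤
      Real.log F.card * (1 + (k - 1) * ε) + ε := by
    have := mul_nonneg (mul_nonneg hL (by linarith : (0 : ℝ) ≤ k - 1))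
      (by linarith : 0 ≤ ε - (1 - g))
    linarith
  have h6 := mul_le_mul_of_nonneg_left h5 hK.le
  linarith

end Union

/-! ### Comparison of the two entropy bounds. -/

theorem exists_mem_of_nonempty_of_ne {n : ℕ} {F : Finset (Finset (Fin n))} (hF : F.Nonempty)
    (hF0 : F ≠ {∅}) : ∃ A ∈ F, A.Nonempty := by
  by_contra! h
  exact hF0 (Finset.eq_singleton_iff_nonempty_unique_mem.2 ⟨hF, h⟩)

theorem zConst_le_one {k : ℕ} (hk : 2 ≤ k) : zConst k ≤ 1 := by
  rw [zConst_eq_exp hk]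
  linarith [Real.exp_pos (-(Real.log (muConst k) / (k - 1)))]

/-- If `μ_k x ^ (k - 1) ≤ 1 + D` then `x ≤ 1 - z_k + D ^ (1 / (k - 1))`. -/
theorem zConst_sub_rpow_le {k : ℕ} (hk : 2 ≤ k) {x D : ℝ} (hx : 0 ≤ x) (hD : 0 ≤ D)
    (h : muConst k * x ^ (k - 1) ≤ 1 + D) :
    zConst k - D ^ (1 / ((k : ℝ) - 1)) ≤ 1 - x := by
  have hk1 : (2 : ℝ) ≤ k := by exact_mod_cast hk
  have hμ := muConst_pos hk
  have hμ1 := one_le_muConst hk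
  have e : (1 : ℝ) / (k - 1) = ((k - 1 : ℕ) : ℝ)⁻¹ := by
    rw [Nat.cast_sub (by omega), Nat.cast_one, one_div]
  have hp0 : 0 ≤ (1 : ℝ) / (k - 1) := div_nonneg zero_le_one (by linarith)
  have hp1 : (1 : ℝ) / (k - 1) ≤ 1 := (div_le_one (by linarith)).2 (by linarith)
  -- The factor 1/μ_k ≤ 1 on D is discarded; subadditivity of the power 1/(k-1) ≤ 1 then separates 1
  -- - z_k from the error.
  have h1 : x ^ (k - 1) ≤ (muConst k)⁻¹ + D := by
    rw [← mul_le_mul_iff_right₀ hμ, mul_add, mul_inv_cancel₀ hμ.ne']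
    nlinarith
  have h2 := Real.rpow_le_rpow (by positivity) h1 hp0
  rw [e, Real.pow_rpow_inv_natCast hx (by omega), ← e] at h2
  have h3 := Real.rpow_add_le_add_rpow (inv_pos.2 hμ).le hD hp0 hp1
  have h4 : zConst k = 1 - (muConst k)⁻¹ ^ ((1 : ℝ) / (k - 1)) := by
    rw [zConst, Real.inv_rpow hμ.le, ← Real.rpow_neg hμ.le, ← div_neg, neg_sub]
  linarith

/-- Since 2 log 2 > 1, the additive ε of the entropy bound is absorbed in the second summand of δ.
-/
theorem le_two_mul_log_one_div {ε : ℝ} (h0 : 0 ≤ ε) (h1 : ε < 1 / 2) :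
    ε ≤ 2 * ε * Real.log (1 / ε) := by
  rcases h0.eq_or_lt with rfl | h0
  · simp
  have h2 : Real.log 2 ≤ Real.log (1 / ε) := by
    refine Real.log_le_log (by norm_num) ?_
    rw [le_div_iff₀ h0]
    linarith
  nlinarith [Real.log_two_gt_d9]

/-- Some point lies in at least a `z_k - δ` fraction of the members of an approximately `k`-union
closed family. -/
theorem exists_frequent_point {k : ℕ} (hk : 2 ≤ k) {n : ℕ} {F : Finset (Finset (Fin n))} {ε : ℝ}
    (h0 : 0 ≤ ε) (h1 : ε < 1 / 2) (hF : F.Nonempty) (hF0 : F ≠ {∅})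
    (h : IsApproxUnionClosed k (1 - ε) F) :
    ∃ i : Fin n,
      zConst k - ((k : ℝ) * ε + 2 * ε * Real.log (1 / ε) / Real.log (F.card : ℝ)) ^
          (1 / ((k : ℝ) - 1)) ≤
        ((F.filter fun A => i ∈ A).card : ℝ) / (F.card : ℝ) := by
  obtain ⟨A, hA, i₀, hi₀⟩ := exists_mem_of_nonempty_of_ne hF hF0
  have hk1 : (2 : ℝ) ≤ k := by exact_mod_cast hk
  have hN1 : (1 : ℝ) ≤ F.card := by exact_mod_cast card_pos.2 hF
  have hL0 : 0 ≤ Real.log F.card := Real.log_nonneg hN1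
  have hε := le_two_mul_log_one_div h0 h1
  have hD : 0 ≤ (k : ℝ) * ε + 2 * ε * Real.log (1 / ε) / Real.log (F.card : ℝ) :=
    add_nonneg (by positivity) (div_nonneg (h0.trans hε) hL0)
  -- If |F| = 1, division by log |F| is impossible, but a point of the only member has frequency 1 ≥
  -- z_k.
  rcases (Nat.one_le_iff_ne_zero.2 (card_pos.2 hF).ne').eq_or_lt with hc | hc
  · refine ⟨i₀, ?_⟩
    obtain ⟨B, rfl⟩ := card_eq_one.1 hc.symm
    obtain rfl := mem_singleton.1 hA
    have e : ({A} : Finset (Finset (Fin n))).filter (fun B => i₀ ∈ B) = {A} := by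
      rw [filter_singleton, if_pos hi₀]
    rw [e, card_singleton, Nat.cast_one, div_one]
    have := Real.rpow_nonneg hD (1 / ((k : ℝ) - 1))
    rw [card_singleton, Nat.cast_one] at this
    linarith [zConst_le_one hk]
  have hN : (0 : ℝ) < F.card := by linarith
  have hL : 0 < Real.log F.card := Real.log_pos (by exact_mod_cast hc)
  obtain ⟨i, -, hi⟩ := exists_max_image univ (fun i : Fin n => (F.filter fun A => i ∈ A).card)
    ⟨i₀, mem_univ _⟩
  refine ⟨i, ?_⟩
  set q := (F.filter fun A => i ∈ A).card with hq
  have hqN : (q : ℝ) ≤ F.card := by exact_mod_cast card_filter_le _ _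
  have hmiss : ∀ j : Fin n, (F.card : ℝ) - q ≤ (F.filter fun A => j ∉ A).card := by
    intro j
    have h2 : ((F.filter fun A => j ∈ A).card : ℝ) + (F.filter fun A => j ∉ A).card = F.card := by
      exact_mod_cast card_filter_add_card_filter_not (s := F) (fun A => j ∈ A)
    have h3 : ((F.filter fun A => j ∈ A).card : ℝ) ≤ q := by exact_mod_cast hi j (mem_univ j)
    linarith
  have hmain := (logFiberSum_union_le hk F (sub_nonneg.2 hqN) hmiss).trans
    (logFiberSum_union_ge hF (by omega) (by linarith) h)
  set x := 1 - (q : ℝ) / F.card with hx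
  have hx0 : 0 ≤ x := sub_nonneg.2 ((div_le_one hN).2 hqN)
  have e : (q : ℝ) / F.card = 1 - x := by rw [hx]; ring
  have e2 : (F.card : ℝ) - q = F.card * x := by
    rw [hx, mul_sub, mul_one, mul_div_cancel₀ _ hN.ne']
  rw [e]
  refine zConst_sub_rpow_le hk hx0 hD ?_
  -- Cancelling |F|^k replaces the count |F| - q by the fraction x.
  have e3 : muConst k * ((F.card : ℝ) - q) ^ (k - 1) * (F.card * Real.log F.card) =
      F.card ^ k * (muConst k * x ^ (k - 1) * Real.log F.card) := by
    have : (F.card : ℝ) ^ k = F.card ^ (k - 1) * F.card := by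
      rw [← pow_succ]; congr 1; omega
    rw [e2, mul_pow, this]
    ring
  rw [e3] at hmain
  have h2 := le_of_mul_le_mul_left hmain (pow_pos hN k)
  rw [← mul_le_mul_iff_left₀ hL]
  refine h2.trans ?_
  have e4 : (1 + ((k : ℝ) * ε + 2 * ε * Real.log (1 / ε) / Real.log F.card)) * Real.log F.card =
      Real.log F.card * (1 + k * ε) + 2 * ε * Real.log (1 / ε) := by
    rw [← add_assoc, add_mul, div_mul_cancel₀ _ hL.ne', mul_comm]
  rw [e4]
  have := mul_nonneg hL.le h0
  linarith

theorem theorem1p5 :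
    (∀ k : ℕ, 2 ≤ k → ∀ (n : ℕ) (F : Finset (Finset (Fin n))) (ε : ℝ),
      0 ≤ ε → ε < 1 / 2 → F.Nonempty → F ≠ {∅} → IsApproxUnionClosed k (1 - ε) F →
      ∃ i : Fin n,
        zConst k -
            ((k : ℝ) * ε + 2 * ε * Real.log (1 / ε) / Real.log (F.card : ℝ)) ^
              (1 / ((k : ℝ) - 1)) ≤
          ((F.filter fun A => i ∈ A).card : ℝ) / (F.card : ℝ)) ∧
    (zConst 2 = psiConst 2 ∧ zConst 3 = psiConst 3 ∧ zConst 4 = psiConst 4) ∧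
    (∀ k : ℕ, 2 ≤ k →
      Real.log (k : ℝ) / (3 * (k : ℝ)) < zConst k ∧
      1 / 2 < zConst k / psiConst k ∧
      zConst k / psiConst k ≤ 1) ∧
    Tendsto (fun k : ℕ => zConst k / psiConst k) atTop
      (𝓝 (Real.log (1 / phi) / Real.log 2)) ∧
    |Real.log (1 / phi) / Real.log 2 - 0.6943| < 0.0001 := by
  exact ⟨fun k hk n F ε h0 h1 hF hF0 h => exists_frequent_point hk h0 h1 hF hF0 h,
    ⟨zConst_eq_psiConst le_rfl (by norm_num), zConst_eq_psiConst (by norm_num) (by norm_num),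
      zConst_eq_psiConst (by norm_num) le_rfl⟩,
    fun k hk => zConst_bounds hk, tendsto_zConst_div_psiConst,
    abs_log_one_div_phi_div_log_two_sub_lt⟩
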